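/- Let $d\ge 2$, let $\mu$ be the uniform probability measure on $\mathbb S^{d-1}\subset\mathbb R^d$, and let $U\sim\mu$. For $\theta\in(-1,1)$, $p\in[0,1]$ and $v\in\mathbb S^{d-1}$ let $C_\theta(v)=\{u\in\mathbb S^{d-1}:\langle u,v\rangle\ge\theta\}$, and let $\mathrm{PrivUnit}(p,\theta)$ be the local randomizer that on input $v$ outputs a $\mu$-uniform point of $C_\theta(v)$ with probability $p$ and a $\mu$-uniform point of $\mathbb S^{d-1}\setminus C_\theta(v)$ with probability $1-p$; write $\mathcal R_v$ for its output law. Put $q=\Pr(\langle U,v\rangle<\theta)$ and $\alpha=\mathbb E[\langle U,v\rangle\mid\langle U,v\rangle\ge\theta]$; these depend only on $(\theta,d)$. Take $\mu$ as blanket distribution, let $\mathcal R_\perp:=\mu$, and let $\gamma$ be the blanket mass, i.e. the largest $\gamma\in(0,1]$ such that for every $v$ one has $\mathcal R_v=\gamma\mu+(1-\gamma)Q_v$ with a probability measure $Q_v$ (if there is no such $\gamma$, put $\chi_{\mathrm{lo}}:=0$). The lower shuffle index is $$\chi_{\mathrm{lo}}=\Bigl(\sup_{(x,x')}\sqrt{\tfrac1\gamma\,\mathrm{Var}_{Y\sim\mu}\Bigl[\tfrac{d\mathcal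 R_{x}}{d\mu}(Y)-\tfrac{d\mathcal R_{x'}}{d\mu}(Y)\Bigr]}\Bigr)^{-1}\in[0,\infty],$$ the supremum being over the pairs $(x,x')$ in $\mathbb S^{d-1}\cup\{\perp\}$ of which exactly one entry is $\perp$. A (possibly randomized) estimator $\widehat x$ of the input from $Y$ is unbiased if $\mathbb E_{Y\sim\mathcal R_v}[\widehat x(Y)]=v$ for all $v\in\mathbb S^{d-1}$, and its worst-case mean squared error is $\mathsf{Err}_1(\widehat x)=\sup_{v\in\mathbb S^{d-1}}\mathbb E_{Y\sim\mathcal R_v}\|\widehat x(Y)-v\|_2^2$. Let $$C(\theta,d)=\frac{q}{(1-q)\,d\,\alpha^2}.$$ Then the following hold. 1. For all $d\ge2$ and $\theta\in(-1,1)$ one has $C(\theta,d)>0$; as $p$ varies, $\chi_{\mathrm{lo}}$ takes arbitrarily large finite values; and, for fixed $d$ and $\theta$, as $\chi_{\mathrm{lo}}\to\infty$ (through finite values), $$\min_{\widehat x\ \text{unbiased}}\mathsf{Err}_1(\widehat x)=C(\theta,d)\,d\,\chi_{\mathrm{lo}}^2\bigl(1+O(\chi_{\mathrm{lo}}^{-1})\bigr),$$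 with an implied constant that depends only on $(\theta,d)$. The minimum is over all unbiased estimators, randomized ones included, and is attained by a deterministic one. 2. $\displaystyle\liminf_{d\to\infty}\ \inf_{\theta\in(-1,1)}C(\theta,d)\ \ge\ \frac{\pi}{2}.$ 3. Consequently PrivUnit misses $d\,\chi_{\mathrm{lo}}^2$ by a constant factor: for every $c<\pi/2$ there is $d_0$ such that for all $d\ge \max(d_0,2)$ and all $\theta\in(-1,1)$, every unbiased estimator for $\mathrm{PrivUnit}(p,\theta)$ satisfies $\mathsf{Err}_1\ge c\,d\,\chi_{\mathrm{lo}}^2$ whenever $\chi_{\mathrm{lo}}$ is finite and larger than a threshold depending on $(c,\theta,d)$. -/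

import Mathlib

open MeasureTheory ProbabilityTheory Filter Topology
open scoped ENNReal

noncomputable section

namespace ShuffleDP

/-! ## Local randomizers, blanket mass, lower shuffle index

A local randomizer is given by the family `R : X → Measure Y` of its output laws. -/

section General

variable {X Y : Type*} [MeasurableSpace Y]

/-- `ν` is a blanket distribution of `R` with blanket mass `γ`:
`R x = γ ν + (1 - γ) Q x` for probability measures `Q x`. -/
def IsBlanket (R : X → Measure Y) (ν : Measure Y) (γ : ℝ≥0∞) : Prop :=
  0 < γ ∧ γ ≤ 1 ∧
    ∀ x, ∃ Q : Measure Y, IsProbabilityMeasure Q ∧ R x = γ • ν + (1 - γ) • Q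

/-- The (maximal) blanket mass of `R` with respect to the blanket distribution `ν`. -/
def blanketMass (R : X → Measure Y) (ν : Measure Y) : ℝ≥0∞ :=
  sSup {γ | IsBlanket R ν γ}

/-- The randomizer extended to the domain with the extra symbol `⊥` (here `none`),
whose output law is the blanket distribution. -/
def extend (R : X → Measure Y) (ν : Measure Y) : Option X → Measure Y
  | none => ν
  | some x => R x

/-- Zero-out adjacency on the extended domain. -/
def ZeroOut (a b : Option X) : Prop :=
  (a = none ∧ b ≠ none) ∨ (b = none ∧ a ≠ none)

/-- The privacy amplification random variable `(dP/dν) - e^ε (dP'/dν)`. -/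
def ampVar (ε : ℝ) (P P' ν : Measure Y) (y : Y) : ℝ :=
  (P.rnDeriv ν y).toReal - Real.exp ε * (P'.rnDeriv ν y).toReal

/-- The lower shuffle index of `R` with blanket distribution `ν`, with values in `[0, ∞]`. -/
def chiLo (R : X → Measure Y) (ν : Measure Y) : ℝ≥0∞ :=
  (⨆ (a : Option X) (b : Option X) (_ : ZeroOut a b),
    ((blanketMass R ν)⁻¹ *
      evariance (ampVar 0 (extend R ν a) (extend R ν b) ν) ν) ^ (1 / 2 : ℝ))⁻¹

end General

/-! ## The sphere and PrivUnit -/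

/-- `ℝ^d` with its Euclidean norm. -/
abbrev E (d : ℕ) : Type := EuclideanSpace ℝ (Fin d)

/-- The unit sphere `S^{d-1}` of `ℝ^d`. -/
abbrev Sph (d : ℕ) : Type := Metric.sphere (0 : E d) 1

/-- The uniform probability measure on `S^{d-1}` (normalized surface measure). -/
def unif (d : ℕ) : Measure (Sph d) :=
  ProbabilityTheory.cond (volume : Measure (E d)).toSphere Set.univ

/-- The spherical cap `{u : ⟨u, v⟩ ≥ θ}`. -/
def cap (d : ℕ) (θ : ℝ) (v : Sph d) : Set (Sph d) :=
  {u | θ ≤ inner ℝ (u : E d) (v : E d)}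

/-- `q = P(⟨U, v⟩ < θ)` for `U` uniform on the sphere. -/
def capQ (d : ℕ) (θ : ℝ) (v : Sph d) : ℝ :=
  (unif d).real {u | inner ℝ (u : E d) (v : E d) < θ}

/-- `α = E[⟨U, v⟩ | ⟨U, v⟩ ≥ θ]` for `U` uniform on the sphere. -/
def capMean (d : ℕ) (θ : ℝ) (v : Sph d) : ℝ :=
  ∫ u, inner ℝ (u : E d) (v : E d) ∂(ProbabilityTheory.cond (unif d) (cap d θ v))

/-- `PrivUnit(p, θ)`: on input `v`, output a uniform point of the cap around `v` with
probability `p`, and a uniform point of its complement with probability `1 - p`. -/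
def privUnit (d : ℕ) (p θ : ℝ) (v : Sph d) : Measure (Sph d) :=
  ENNReal.ofReal p • ProbabilityTheory.cond (unif d) (cap d θ v) +
    ENNReal.ofReal (1 - p) • ProbabilityTheory.cond (unif d) (cap d θ v)ᶜ

/-- The lower shuffle index of PrivUnit, whose blanket distribution is uniform. -/
def privUnitChi (d : ℕ) (p θ : ℝ) : ℝ≥0∞ :=
  chiLo (privUnit d p θ) (unif d)

/-! ## Estimators

A (possibly randomized) estimator is a Markov kernel from outputs to `ℝ^d`; a deterministic
estimator `f` is `Kernel.deterministic f hf`. The law of the estimate on input `v` is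
`(R v).bind κ`. -/

/-- Unbiasedness: on every input `v`, the estimate is integrable with mean `v`. -/
def Unbiased {d : ℕ} (R : Sph d → Measure (Sph d)) (κ : Kernel (Sph d) (E d)) : Prop :=
  ∀ v, Integrable (fun x : E d => x) ((R v).bind κ) ∧ ∫ x, x ∂((R v).bind κ) = (v : E d)

/-- Worst-case mean squared error over the inputs in the sphere. -/
def err {d : ℕ} (R : Sph d → Measure (Sph d)) (κ : Kernel (Sph d) (E d)) : ℝ≥0∞ :=
  ⨆ v : Sph d, ∫⁻ x, ‖x - (v : E d)‖ₑ ^ 2 ∂((R v).bind κ)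

end ShuffleDP

end

/-!
PrivUnit has a two-valued density with respect to the uniform measure `μ` on the sphere: `a` on
the cap around the input and `b` off it (`privUnit_eq_withDensity`). Writing `w = q (1 - q)` and
`t = p - (1 - q)`, one has `a - b = t / w`, the blanket mass is `γ = min a b`, and the variance in
the shuffle index is `t² / w` for every admissible pair, so `χ² = γ w / t²`
(`privUnitChi_eq_ofReal`, `of_privUnitChi_eq_ofReal`).

By rotation invariance the mean output on input `v` is `m v` with `m = t I / w`, where
`I = E[⟨U, v⟩ ; ⟨U, v⟩ ≥ θ]`. The estimator `u / m` is unbiased with error `1 / m² - 1` on every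
input (`err_scaleEst`). It is optimal (`le_err_of_unbiased`): if the input is drawn from `μ` then
so is the output, and averaging the unbiasedness relation over inputs gives `E⟨g(Y), Y⟩ = 1 / m`
for the conditional mean `g` of any unbiased estimate, whence the averaged error is at least
`1 / m² - 1`. Now `C d χ² = γ / m²`, and both `1 - γ` and `m²` are `O(χ⁻¹)`; this is the
asymptotic formula (`exists_relative_error`).

The constant equals `C = w / (d I²)`, so the lower bound `π / 2` asks for a bound on the first
moment of a cap that is uniform in `θ`. A standard Gaussian vector `G` in `ℝ^d` has independent
norm and direction, so `E‖G‖ · I` is the integral of the standard Gaussian variable `⟨G, v⟩` over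
the cone above the cap, an event of probability `1 - q`. By the bathtub principle
(`setIntegral_le_gaussDens`) it is at most the same integral over a half-line of equal
probability, which is the Gaussian density `φ(s)` at the point `s` with `Φ(s) = q`. A
one-variable inequality, `φ(s)² ≤ (2 / π) Φ(s) (1 - Φ(s))` (`sq_gaussDens_le`), and
`E‖G‖ ≥ √d (1 - 1 / d)` (`sqrt_mul_le_radialMoment_one`) give `C ≥ (π / 2) (1 - 1 / d)²` for all
`θ` (`le_privConst`).
-/

namespace ShuffleDP

/-! ### The uniform measure on the sphere and its rotation invariance -/

section Sphere

variable {d : ℕ}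

lemma norm_coe_sph (u : Sph d) : ‖(u : E d)‖ = 1 := by
  simp

lemma inner_coe_self_sph (u : Sph d) : inner ℝ (u : E d) (u : E d) = 1 := by
  rw [real_inner_self_eq_norm_sq, norm_coe_sph, one_pow]

lemma abs_inner_sph_le_one (u v : Sph d) : |inner ℝ (u : E d) (v : E d)| ≤ 1 := by
  simpa [norm_coe_sph] using abs_real_inner_le_norm (u : E d) (v : E d)

lemma continuous_inner_sph (v : Sph d) :
    Continuous fun u : Sph d => inner ℝ (u : E d) (v : E d) := by
  fun_prop

lemma measurableSet_cap (θ : ℝ) (v : Sph d) : MeasurableSet (cap d θ v) :=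
  (isClosed_le continuous_const (continuous_inner_sph v)).measurableSet

lemma compl_cap (θ : ℝ) (v : Sph d) :
    (cap d θ v)ᶜ = {u : Sph d | inner ℝ (u : E d) (v : E d) < θ} := by
  ext u
  change ¬ (θ ≤ _) ↔ _
  exact not_le

lemma unif_eq_smul (d : ℕ) :
    unif d = ((volume : Measure (E d)).toSphere Set.univ)⁻¹ •
      (volume : Measure (E d)).toSphere := by
  simp [unif, ProbabilityTheory.cond]

instance isProbabilityMeasure_unif [NeZero d] : IsProbabilityMeasure (unif d) :=
  cond_isProbabilityMeasure (by
    simpa [NeZero.ne d] using (Metric.isOpen_ball.measure_pos volume ⟨(0 : E d), by simp⟩).ne')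

instance isOpenPosMeasure_unif [NeZero d] : (unif d).IsOpenPosMeasure := by
  rw [unif_eq_smul]
  refine ⟨fun U hU hne => ?_⟩
  rw [Measure.smul_apply, smul_eq_mul]
  exact mul_ne_zero (ENNReal.inv_ne_zero.2 (measure_ne_top _ _)) (hU.measure_ne_zero _ hne)

/-- The action of a linear isometry of `ℝ^d` on the unit sphere. -/
noncomputable def sphMap (L : E d ≃ₗᵢ[ℝ] E d) (u : Sph d) : Sph d :=
  ⟨L u, by simp⟩

@[simp] lemma coe_sphMap (L : E d ≃ₗᵢ[ℝ] E d) (u : Sph d) : (sphMap L u : E d) = L u := rfl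

lemma continuous_sphMap (L : E d ≃ₗᵢ[ℝ] E d) : Continuous (sphMap L) :=
  Continuous.subtype_mk (by fun_prop) _

open scoped Pointwise in
/-- The uniform measure on the sphere is invariant under linear isometries, because the
volume of the cone over a set of directions is. -/
lemma measurePreserving_sphMap (L : E d ≃ₗᵢ[ℝ] E d) :
    MeasurePreserving (sphMap L) (unif d) (unif d) := by
  refine ⟨(continuous_sphMap L).measurable, ?_⟩
  rw [unif_eq_smul, Measure.map_smul]
  congr 1
  ext s hs
  have hs' := (continuous_sphMap L).measurable hs
  rw [Measure.map_apply (continuous_sphMap L).measurable hs, Measure.toSphere_apply' _ hs,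
    Measure.toSphere_apply' _ hs',
    ← (show MeasurePreserving L.toHomeomorph.toMeasurableEquiv volume volume from
      L.measurePreserving).measure_preimage_equiv (Set.Ioo (0 : ℝ) 1 • (((↑) : Sph d → E d) '' s))]
  congr 2
  ext x
  constructor
  · rintro ⟨r, hr, _, ⟨u, hu, rfl⟩, rfl⟩
    exact ⟨r, hr, L u, ⟨sphMap L u, hu, rfl⟩, by simp⟩
  · rintro ⟨r, hr, _, ⟨u, hu, rfl⟩, hx⟩
    refine ⟨r, hr, L.symm u, ⟨sphMap L.symm u, ?_, rfl⟩, ?_⟩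
    · have : sphMap L (sphMap L.symm u) = u := Subtype.ext (by simp)
      simpa [this] using hu
    · apply L.injective
      simpa using hx

lemma integral_comp_sphMap {F : Type*} [NormedAddCommGroup F] [NormedSpace ℝ F]
    (L : E d ≃ₗᵢ[ℝ] E d) {g : Sph d → F} (hg : AEStronglyMeasurable g (unif d)) :
    ∫ u, g (sphMap L u) ∂(unif d) = ∫ u, g u ∂(unif d) := by
  have h := measurePreserving_sphMap L
  rw [← integral_map h.aemeasurable (by rwa [h.map_eq]), h.map_eq]

lemma exists_isometry_map_eq (v w : Sph d) : ∃ L : E d ≃ₗᵢ[ℝ] E d, L (v : E d) = w :=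
  ⟨_, Submodule.reflection_sub (by rw [norm_coe_sph, norm_coe_sph])⟩

/-- Any functional of `⟨U, v⟩` has a law that does not depend on `v`. -/
lemma map_inner_unif_congr (v w : Sph d) :
    (unif d).map (fun u : Sph d => inner ℝ (u : E d) (v : E d)) =
      (unif d).map (fun u : Sph d => inner ℝ (u : E d) (w : E d)) := by
  obtain ⟨L, hL⟩ := exists_isometry_map_eq v w
  have h := measurePreserving_sphMap L
  conv_rhs => rw [← h.map_eq]
  rw [Measure.map_map (continuous_inner_sph w).measurable h.measurable]
  congr 1
  ext u
  simp [← hL]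

/-! ### Caps: mass, first moment, centroid -/

lemma integrable_unif_of_bounded [NeZero d] {F : Type*} [NormedAddCommGroup F]
    {g : Sph d → F} (hg : AEStronglyMeasurable g (unif d)) (C : ℝ) (hC : ∀ u, ‖g u‖ ≤ C) :
    Integrable g (unif d) :=
  Integrable.of_bound hg C (Eventually.of_forall hC)

lemma integrable_coe_sph [NeZero d] : Integrable (fun u : Sph d => (u : E d)) (unif d) :=
  integrable_unif_of_bounded (by fun_prop) 1 fun u => (norm_coe_sph u).le

lemma integrable_inner_sph [NeZero d] (v : Sph d) :
    Integrable (fun u : Sph d => inner ℝ (u : E d) (v : E d)) (unif d) :=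
  integrable_unif_of_bounded (continuous_inner_sph v).aestronglyMeasurable 1
    fun u => abs_inner_sph_le_one u v

/-- The unnormalized first moment `E[⟨U, v⟩ ; ⟨U, v⟩ ≥ θ]` of a cap in the direction of
its centre. -/
noncomputable def capInt (d : ℕ) (θ : ℝ) (v : Sph d) : ℝ :=
  ∫ u in cap d θ v, inner ℝ (u : E d) (v : E d) ∂(unif d)

lemma capQ_congr (θ : ℝ) (v w : Sph d) : capQ d θ v = capQ d θ w := by
  have h := congrArg (fun m => m.real (Set.Iio θ)) (map_inner_unif_congr v w)
  rwa [map_measureReal_apply (continuous_inner_sph v).measurable measurableSet_Iio,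
    map_measureReal_apply (continuous_inner_sph w).measurable measurableSet_Iio] at h

lemma capInt_congr (θ : ℝ) (v w : Sph d) : capInt d θ v = capInt d θ w := by
  have h := congrArg (fun m => ∫ x in Set.Ici θ, x ∂m) (map_inner_unif_congr v w)
  rwa [setIntegral_map measurableSet_Ici (by fun_prop)
      (continuous_inner_sph v).measurable.aemeasurable,
    setIntegral_map measurableSet_Ici (by fun_prop)
      (continuous_inner_sph w).measurable.aemeasurable] at h

lemma isOpen_openCap (θ : ℝ) (v : Sph d) :
    IsOpen {u : Sph d | θ < inner ℝ (u : E d) (v : E d)} :=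
  isOpen_lt continuous_const (continuous_inner_sph v)

lemma measureReal_compl_cap (θ : ℝ) (v : Sph d) :
    (unif d).real (cap d θ v)ᶜ = capQ d θ v := by
  rw [compl_cap, capQ]

lemma integral_coe_unif : ∫ u, (u : E d) ∂(unif d) = 0 := by
  have h := integral_comp_sphMap (d := d) (LinearIsometryEquiv.neg ℝ)
    (g := fun u => (u : E d)) (by fun_prop)
  simp only [coe_sphMap, LinearIsometryEquiv.coe_neg, integral_neg] at h
  have h2 : (2 : ℝ) • ∫ u, (u : E d) ∂(unif d) = 0 := by
    rw [two_smul]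
    nth_rewrite 1 [← h]
    exact neg_add_cancel _
  simpa using h2

variable [NeZero d]

lemma nonempty_sph (d : ℕ) [NeZero d] : Nonempty (Sph d) := by
  obtain ⟨x, hx⟩ := exists_norm_eq (E d) (zero_le_one' ℝ)
  exact ⟨⟨x, by simpa using hx⟩⟩

lemma measureReal_cap (θ : ℝ) (v : Sph d) : (unif d).real (cap d θ v) = 1 - capQ d θ v := by
  rw [← measureReal_compl_cap, probReal_compl_eq_one_sub (measurableSet_cap θ v)]
  ring

lemma capQ_pos {θ : ℝ} (hθ : -1 < θ) (v : Sph d) : 0 < capQ d θ v := by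
  have ho : IsOpen {u : Sph d | inner ℝ (u : E d) (v : E d) < θ} :=
    isOpen_lt (continuous_inner_sph v) continuous_const
  refine ENNReal.toReal_pos (ho.measure_ne_zero _ ⟨-v, ?_⟩) (measure_ne_top _ _)
  simp only [Set.mem_ofPred_eq, Metric.sphere, Set.mem_ofPred_eq, coe_neg_sphere, inner_neg_left,
    inner_coe_self_sph]
  exact hθ

lemma capQ_lt_one {θ : ℝ} (hθ : θ < 1) (v : Sph d) : capQ d θ v < 1 := by
  have h : 0 < (unif d).real (cap d θ v) := by
    refine ENNReal.toReal_pos (ne_of_gt (lt_of_lt_of_le ?_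
      (measure_mono (s := {u : Sph d | θ < inner ℝ (u : E d) (v : E d)}) fun u hu => ?_)))
      (measure_ne_top _ _)
    · exact (isOpen_openCap θ v).measure_pos _ ⟨v, by simpa [norm_coe_sph] using hθ⟩
    · exact (show θ < _ from hu).le
  rw [measureReal_cap] at h
  linarith

lemma integral_inner_unif (v : Sph d) : ∫ u, inner ℝ (u : E d) (v : E d) ∂(unif d) = 0 := by
  have h := integral_inner (𝕜 := ℝ) integrable_coe_sph (v : E d)
  rw [integral_coe_unif, inner_zero_right] at h
  rw [← h]
  exact integral_congr_ae (Eventually.of_forall fun u => real_inner_comm _ _)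

/-- The centroid of a cap points to its centre: it is fixed by the reflection in the line
through the centre. -/
lemma setIntegral_cap_coe (θ : ℝ) (v : Sph d) :
    ∫ u in cap d θ v, (u : E d) ∂(unif d) = capInt d θ v • (v : E d) := by
  set J := ∫ u in cap d θ v, (u : E d) ∂(unif d) with hJ
  have hin : inner ℝ (v : E d) J = capInt d θ v := by
    rw [hJ, ← integral_inner integrable_coe_sph.integrableOn]
    exact integral_congr_ae (Eventually.of_forall fun u => real_inner_comm _ _)
  set L := (ℝ ∙ (v : E d)).reflection with hL
  have hLv : L (v : E d) = v := by
    simp [hL, Submodule.reflection_singleton_apply, two_smul]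
  have hfix : L J = J := by
    have h1 : L J = ∫ u in cap d θ v, L (u : E d) ∂(unif d) :=
      (ContinuousLinearMap.integral_comp_comm (L : E d →L[ℝ] E d)
        integrable_coe_sph.integrableOn).symm
    have h2 := integral_comp_sphMap L
      (g := (cap d θ v).indicator fun u => (u : E d))
      ((Continuous.aestronglyMeasurable (by fun_prop)).indicator (measurableSet_cap θ v))
    rw [h1, hJ, ← integral_indicator (measurableSet_cap θ v),
      ← integral_indicator (measurableSet_cap θ v), ← h2]
    congr 1
    ext1 u
    have hmem : sphMap L u ∈ cap d θ v ↔ u ∈ cap d θ v := by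
      have : inner ℝ (L (u : E d)) (v : E d) = inner ℝ (u : E d) (v : E d) := by
        conv_lhs => rw [← hLv, L.inner_map_map]
      simp only [cap, Set.mem_ofPred_eq, coe_sphMap, this]
    by_cases hu : u ∈ cap d θ v
    · rw [Set.indicator_of_mem hu, Set.indicator_of_mem (hmem.2 hu), coe_sphMap]
    · rw [Set.indicator_of_notMem hu, Set.indicator_of_notMem (mt hmem.1 hu)]
  rw [hL, Submodule.reflection_singleton_apply, norm_coe_sph, hin] at hfix
  have h3 : (2 : ℝ) • (capInt d θ v • (v : E d)) = (2 : ℝ) • J := by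
    rw [two_smul ℝ J]
    nth_rewrite 1 [← hfix]
    simp [two_smul]
  exact ((smul_right_injective (E d) (two_ne_zero (α := ℝ))) h3).symm

lemma setIntegral_compl_cap_coe (θ : ℝ) (v : Sph d) :
    ∫ u in (cap d θ v)ᶜ, (u : E d) ∂(unif d) = -(capInt d θ v • (v : E d)) := by
  have h := integral_add_compl (measurableSet_cap θ v) (integrable_coe_sph (d := d))
  rw [integral_coe_unif, setIntegral_cap_coe] at h
  exact (neg_eq_of_add_eq_zero_right h).symm

lemma capInt_pos {θ : ℝ} (hθ : θ ∈ Set.Ioo (-1 : ℝ) 1) (v : Sph d) : 0 < capInt d θ v := by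
  rcases le_or_gt 0 θ with h0 | h0
  · rw [capInt, setIntegral_pos_iff_support_of_nonneg_ae]
    · refine lt_of_lt_of_le ((isOpen_openCap θ v).measure_pos (unif d)
        ⟨v, by simpa [norm_coe_sph] using hθ.2⟩) (measure_mono fun u hu => ⟨?_, (show θ < _ from hu).le⟩)
      exact (h0.trans_lt (show θ < _ from hu)).ne'
    · filter_upwards [ae_restrict_mem (measurableSet_cap θ v)] with u hu
      exact h0.trans hu
    · exact (integrable_inner_sph v).integrableOn
  · -- For `θ < 0` the complementary cap carries a negative moment, and the total moment is `0`.
    have h := integral_add_compl (measurableSet_cap θ v) (integrable_inner_sph v)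
    rw [integral_inner_unif] at h
    have hneg : 0 < ∫ u in (cap d θ v)ᶜ, -inner ℝ (u : E d) (v : E d) ∂(unif d) := by
      rw [setIntegral_pos_iff_support_of_nonneg_ae]
      · refine lt_of_lt_of_le (b := unif d (cap d θ v)ᶜ) ?_ (measure_mono fun u hu => ⟨?_, hu⟩)
        · have := capQ_pos hθ.1 v
          rw [← measureReal_compl_cap] at this
          exact ENNReal.toReal_pos_iff.1 this |>.1
        · rw [compl_cap] at hu
          exact (neg_pos.2 (lt_trans hu h0)).ne'
      · filter_upwards [ae_restrict_mem (measurableSet_cap θ v).compl] with u hu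
        rw [compl_cap] at hu
        exact (neg_pos.2 (lt_trans hu h0)).le
      · exact (integrable_inner_sph v).neg.integrableOn
    rw [integral_neg] at hneg
    change capInt d θ v + _ = 0 at h
    linarith

lemma capMean_eq (θ : ℝ) (v : Sph d) :
    capMean d θ v = capInt d θ v / (1 - capQ d θ v) := by
  rw [capMean, ProbabilityTheory.cond, integral_smul_measure, ENNReal.toReal_inv, ← measureReal_def,
    measureReal_cap, capInt, smul_eq_mul, inv_mul_eq_div]

lemma capInt_le (θ : ℝ) (v : Sph d) : capInt d θ v ≤ 1 - capQ d θ v := by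
  have h : capInt d θ v ≤ ∫ _ in cap d θ v, (1 : ℝ) ∂(unif d) :=
    integral_mono (integrable_inner_sph v).integrableOn (integrable_const _)
      fun u => (le_abs_self _).trans (abs_inner_sph_le_one u v)
  simpa [measureReal_cap] using h

end Sphere

/-! ### The density of PrivUnit -/

section Density

variable {d : ℕ}

/-- The function on the sphere equal to `a` on the cap around `v` and to `b` off the cap. -/
noncomputable def capStep (d : ℕ) (θ a b : ℝ) (v u : Sph d) : ℝ :=
  if θ ≤ inner ℝ (u : E d) (v : E d) then a else b

lemma capStep_of_mem {θ : ℝ} (a b : ℝ) {v u : Sph d} (h : u ∈ cap d θ v) :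
    capStep d θ a b v u = a :=
  if_pos h

lemma capStep_of_notMem {θ : ℝ} (a b : ℝ) {v u : Sph d} (h : u ∉ cap d θ v) :
    capStep d θ a b v u = b :=
  if_neg h

lemma capStep_comm (θ a b : ℝ) (v u : Sph d) : capStep d θ a b v u = capStep d θ a b u v := by
  rw [capStep, capStep, real_inner_comm]

lemma measurable_capStep_uncurry (θ a b : ℝ) :
    Measurable fun z : Sph d × Sph d => capStep d θ a b z.1 z.2 :=
  Measurable.ite (isClosed_le continuous_const (by fun_prop)).measurableSet measurable_const
    measurable_const

lemma measurable_capStep (θ a b : ℝ) (v : Sph d) : Measurable (capStep d θ a b v) :=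
  (measurable_capStep_uncurry θ a b).comp measurable_prodMk_left

lemma abs_capStep_le (θ a b : ℝ) (v u : Sph d) : |capStep d θ a b v u| ≤ max |a| |b| := by
  unfold capStep
  split_ifs
  · exact le_max_left _ _
  · exact le_max_right _ _

lemma capStep_nonneg {a b : ℝ} (ha : 0 ≤ a) (hb : 0 ≤ b) (θ : ℝ) (v u : Sph d) :
    0 ≤ capStep d θ a b v u := by
  unfold capStep
  split_ifs <;> assumption

lemma integrable_capStep_smul {F : Type*} [NormedAddCommGroup F] [NormedSpace ℝ F]
    (θ a b : ℝ) (v : Sph d) {g : Sph d → F} (hg : Integrable g (unif d)) :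
    Integrable (fun u => capStep d θ a b v u • g u) (unif d) :=
  hg.bdd_smul (max |a| |b|) (measurable_capStep θ a b v).aestronglyMeasurable
    (Eventually.of_forall fun u => abs_capStep_le θ a b v u)

lemma integral_capStep_smul {F : Type*} [NormedAddCommGroup F] [NormedSpace ℝ F]
    (θ a b : ℝ) (v : Sph d) {g : Sph d → F} (hg : Integrable g (unif d)) :
    ∫ u, capStep d θ a b v u • g u ∂(unif d) =
      a • ∫ u in cap d θ v, g u ∂(unif d) + b • ∫ u in (cap d θ v)ᶜ, g u ∂(unif d) := by
  have hm := measurableSet_cap θ v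
  rw [← integral_add_compl hm (integrable_capStep_smul θ a b v hg), ← integral_smul,
    ← integral_smul]
  congr 1
  · exact setIntegral_congr_fun hm fun u hu => by simp only [capStep_of_mem a b hu]
  · exact setIntegral_congr_fun hm.compl fun u hu => by simp only [capStep_of_notMem a b hu]

lemma withDensity_capStep_cap (θ a b : ℝ) (v : Sph d) :
    (unif d).withDensity (fun u => ENNReal.ofReal (capStep d θ a b v u)) (cap d θ v) =
      ENNReal.ofReal a * unif d (cap d θ v) := by
  rw [withDensity_apply _ (measurableSet_cap θ v), ← setLIntegral_const]
  exact setLIntegral_congr_fun (measurableSet_cap θ v) fun u hu => by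
    simp only [capStep_of_mem a b hu]

lemma withDensity_capStep_compl_cap (θ a b : ℝ) (v : Sph d) :
    (unif d).withDensity (fun u => ENNReal.ofReal (capStep d θ a b v u)) (cap d θ v)ᶜ =
      ENNReal.ofReal b * unif d (cap d θ v)ᶜ := by
  rw [withDensity_apply _ (measurableSet_cap θ v).compl, ← setLIntegral_const]
  exact setLIntegral_congr_fun (measurableSet_cap θ v).compl fun u hu => by
    simp only [capStep_of_notMem a b hu]

variable [NeZero d]

lemma integral_capStep (θ a b : ℝ) (v : Sph d) :
    ∫ u, capStep d θ a b v u ∂(unif d) = a * (1 - capQ d θ v) + b * capQ d θ v := by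
  have h := integral_capStep_smul θ a b v (integrable_const (μ := unif d) (1 : ℝ))
  simpa [measureReal_cap, measureReal_compl_cap] using h

lemma integrable_capStep (θ a b : ℝ) (v : Sph d) :
    Integrable (capStep d θ a b v) (unif d) :=
  integrable_unif_of_bounded (measurable_capStep θ a b v).aestronglyMeasurable _
    fun u => abs_capStep_le θ a b v u

lemma integral_capStep_smul_coe (θ a b : ℝ) (v : Sph d) :
    ∫ u, capStep d θ a b v u • (u : E d) ∂(unif d) = ((a - b) * capInt d θ v) • (v : E d) := by
  rw [integral_capStep_smul θ a b v integrable_coe_sph, setIntegral_cap_coe,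
    setIntegral_compl_cap_coe]
  module

lemma isProbabilityMeasure_withDensity_capStep {a b : ℝ} (ha : 0 ≤ a) (hb : 0 ≤ b) (θ : ℝ)
    (v : Sph d) (h : a * (1 - capQ d θ v) + b * capQ d θ v = 1) :
    IsProbabilityMeasure
      ((unif d).withDensity fun u => ENNReal.ofReal (capStep d θ a b v u)) := by
  refine ⟨?_⟩
  rw [withDensity_apply _ .univ, Measure.restrict_univ,
    ← ofReal_integral_eq_lintegral_ofReal (integrable_capStep θ a b v)
      (Eventually.of_forall fun u => capStep_nonneg ha hb θ v u), integral_capStep, h,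
    ENNReal.ofReal_one]

lemma unif_cap_eq (θ : ℝ) (v : Sph d) :
    unif d (cap d θ v) = ENNReal.ofReal (1 - capQ d θ v) := by
  rw [← measureReal_cap, ofReal_measureReal]

lemma unif_compl_cap_eq (θ : ℝ) (v : Sph d) :
    unif d (cap d θ v)ᶜ = ENNReal.ofReal (capQ d θ v) := by
  rw [← measureReal_compl_cap, ofReal_measureReal]

/-- PrivUnit has a two-valued density with respect to the uniform measure. -/
lemma privUnit_eq_withDensity {θ : ℝ} (hθ : θ ∈ Set.Ioo (-1 : ℝ) 1) (p : ℝ) (v : Sph d) :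
    privUnit d p θ v = (unif d).withDensity fun u =>
      ENNReal.ofReal (capStep d θ (p / (1 - capQ d θ v)) ((1 - p) / capQ d θ v) v u) := by
  have hm := measurableSet_cap θ v
  have hq := capQ_pos hθ.1 v
  have hq' := sub_pos.2 (capQ_lt_one hθ.2 v)
  have h : (fun u => ENNReal.ofReal
      (capStep d θ (p / (1 - capQ d θ v)) ((1 - p) / capQ d θ v) v u)) =
      (cap d θ v).indicator (fun _ => ENNReal.ofReal (p / (1 - capQ d θ v))) +
        (cap d θ v)ᶜ.indicator (fun _ => ENNReal.ofReal ((1 - p) / capQ d θ v)) := by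
    ext u
    by_cases hu : u ∈ cap d θ v
    · simp [capStep_of_mem _ _ hu, hu]
    · simp [capStep_of_notMem _ _ hu, hu]
  rw [h, withDensity_add_left (measurable_const.indicator hm), withDensity_indicator hm,
    withDensity_indicator hm.compl, withDensity_const, withDensity_const, privUnit,
    ProbabilityTheory.cond, ProbabilityTheory.cond, smul_smul, smul_smul, unif_cap_eq,
    unif_compl_cap_eq, ENNReal.ofReal_div_of_pos hq, ENNReal.ofReal_div_of_pos hq',
    div_eq_mul_inv, div_eq_mul_inv]

lemma privUnit_mass {θ : ℝ} (hθ : θ ∈ Set.Ioo (-1 : ℝ) 1) (p : ℝ) (v : Sph d) :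
    p / (1 - capQ d θ v) * (1 - capQ d θ v) + (1 - p) / capQ d θ v * capQ d θ v = 1 := by
  rw [div_mul_cancel₀ _ (sub_pos.2 (capQ_lt_one hθ.2 v)).ne',
    div_mul_cancel₀ _ (capQ_pos hθ.1 v).ne']
  ring

/-! ### Blanket mass and lower shuffle index of PrivUnit -/

/-- The smaller of the two values of the density of PrivUnit. -/
noncomputable def minDens (d : ℕ) (p θ : ℝ) (v : Sph d) : ℝ :=
  min (p / (1 - capQ d θ v)) ((1 - p) / capQ d θ v)

lemma minDens_nonneg {p θ : ℝ} (hp : p ∈ Set.Icc (0 : ℝ) 1) (hθ : θ ∈ Set.Ioo (-1 : ℝ) 1)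
    (v : Sph d) : 0 ≤ minDens d p θ v :=
  le_min (div_nonneg hp.1 (sub_pos.2 (capQ_lt_one hθ.2 v)).le)
    (div_nonneg (sub_nonneg.2 hp.2) (capQ_pos hθ.1 v).le)

lemma minDens_lt_one {p θ : ℝ} (hθ : θ ∈ Set.Ioo (-1 : ℝ) 1) (v : Sph d)
    (ht : p ≠ 1 - capQ d θ v) : minDens d p θ v < 1 := by
  have hq := capQ_pos hθ.1 v
  have hq' := sub_pos.2 (capQ_lt_one hθ.2 v)
  rcases lt_or_gt_of_ne ht with h | h
  · exact (min_le_left _ _).trans_lt ((div_lt_one hq').2 h)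
  · exact (min_le_right _ _).trans_lt ((div_lt_one hq).2 (by linarith))

lemma le_minDens_of_isBlanket {p θ : ℝ} (hθ : θ ∈ Set.Ioo (-1 : ℝ) 1) (v : Sph d) {γ : ℝ≥0∞}
    (h : IsBlanket (privUnit d p θ) (unif d) γ) : γ ≤ ENNReal.ofReal (minDens d p θ v) := by
  have hq := capQ_pos hθ.1 v
  have hq' := sub_pos.2 (capQ_lt_one hθ.2 v)
  obtain ⟨-, -, h⟩ := h
  obtain ⟨Q, -, hQ⟩ := h v
  rw [privUnit_eq_withDensity hθ] at hQ
  have key : ∀ s, γ * unif d s ≤ (γ • unif d + (1 - γ) • Q) s := fun s => by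
    rw [Measure.add_apply, Measure.smul_apply, smul_eq_mul]
    exact le_self_add
  rw [minDens, ENNReal.ofReal_min]
  refine le_min ?_ ?_
  · have h1 := key (cap d θ v)
    rw [← hQ, withDensity_capStep_cap, unif_cap_eq] at h1
    exact (ENNReal.mul_le_mul_iff_left (by simpa using hq') ENNReal.ofReal_ne_top).1 h1
  · have h1 := key (cap d θ v)ᶜ
    rw [← hQ, withDensity_capStep_compl_cap, unif_compl_cap_eq] at h1
    exact (ENNReal.mul_le_mul_iff_left (by simpa using hq) ENNReal.ofReal_ne_top).1 h1

lemma isBlanket_minDens {p θ : ℝ} (hθ : θ ∈ Set.Ioo (-1 : ℝ) 1) (v : Sph d)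
    (ht : p ≠ 1 - capQ d θ v) (h0 : 0 < minDens d p θ v) :
    IsBlanket (privUnit d p θ) (unif d) (ENNReal.ofReal (minDens d p θ v)) := by
  have h1 := minDens_lt_one hθ v ht
  refine ⟨ENNReal.ofReal_pos.2 h0, by simpa using h1.le, fun x => ?_⟩
  have hcongr : minDens d p θ v = minDens d p θ x := by
    rw [minDens, minDens, capQ_congr θ v x]
  rw [hcongr] at h0 h1 ⊢
  set γ := minDens d p θ x with hγ
  set a := p / (1 - capQ d θ x) with ha
  set b := (1 - p) / capQ d θ x with hb
  have hγa : γ ≤ a := min_le_left _ _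
  have hγb : γ ≤ b := min_le_right _ _
  have h1' : 0 < 1 - γ := sub_pos.2 h1
  have hmass := privUnit_mass hθ p x
  rw [← ha, ← hb] at hmass
  have ha' : 0 ≤ (a - γ) / (1 - γ) := div_nonneg (sub_nonneg.2 hγa) h1'.le
  have hb' : 0 ≤ (b - γ) / (1 - γ) := div_nonneg (sub_nonneg.2 hγb) h1'.le
  refine ⟨_, isProbabilityMeasure_withDensity_capStep ha' hb' θ x ?_, ?_⟩
  · field_simp
    linarith
  · have hmeas : Measurable fun u =>
        ENNReal.ofReal (capStep d θ ((a - γ) / (1 - γ)) ((b - γ) / (1 - γ)) x u) :=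
      (measurable_capStep _ _ _ _).ennreal_ofReal
    rw [privUnit_eq_withDensity hθ, ← withDensity_smul _ hmeas, ← withDensity_const,
      ← withDensity_add_left measurable_const]
    congr 1
    ext u
    have h2 : (1 : ℝ≥0∞) - ENNReal.ofReal γ = ENNReal.ofReal (1 - γ) := by
      rw [ENNReal.ofReal_sub _ h0.le, ENNReal.ofReal_one]
    rw [Pi.add_apply, Pi.smul_apply, smul_eq_mul, h2, ← ENNReal.ofReal_mul h1'.le,
      ← ENNReal.ofReal_add h0.le (mul_nonneg h1'.le (capStep_nonneg ha' hb' θ x u)), ← ha, ← hb]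
    congr 1
    unfold capStep
    split_ifs <;> field_simp <;> ring

lemma blanketMass_privUnit {p θ : ℝ} (hp : p ∈ Set.Icc (0 : ℝ) 1)
    (hθ : θ ∈ Set.Ioo (-1 : ℝ) 1) (v : Sph d) (ht : p ≠ 1 - capQ d θ v) :
    blanketMass (privUnit d p θ) (unif d) = ENNReal.ofReal (minDens d p θ v) := by
  refine le_antisymm (sSup_le fun γ hγ => le_minDens_of_isBlanket hθ v hγ) ?_
  rcases (minDens_nonneg hp hθ v).eq_or_lt with h0 | h0
  · simp [← h0]
  · exact le_sSup (isBlanket_minDens hθ v ht h0)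

lemma variance_capStep (θ a b : ℝ) (v : Sph d) :
    Var[capStep d θ a b v; unif d] = (a - b) ^ 2 * (capQ d θ v * (1 - capQ d θ v)) := by
  have hLp : MemLp (capStep d θ a b v) 2 (unif d) :=
    MemLp.of_bound (measurable_capStep θ a b v).aestronglyMeasurable _
      (Eventually.of_forall fun u => abs_capStep_le θ a b v u)
  have hsq : capStep d θ a b v ^ 2 = capStep d θ (a ^ 2) (b ^ 2) v := by
    ext u
    simp only [Pi.pow_apply, capStep]
    split_ifs <;> rfl
  rw [variance_eq_sub hLp, hsq, integral_capStep, integral_capStep]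
  ring

lemma evariance_ampVar {p θ : ℝ} (hp : p ∈ Set.Icc (0 : ℝ) 1)
    (hθ : θ ∈ Set.Ioo (-1 : ℝ) 1) (v : Sph d) {x y : Option (Sph d)} (hxy : ZeroOut x y) :
    evariance (ampVar 0 (extend (privUnit d p θ) (unif d) x)
      (extend (privUnit d p θ) (unif d) y) (unif d)) (unif d) =
      ENNReal.ofReal ((p - (1 - capQ d θ v)) ^ 2 / (capQ d θ v * (1 - capQ d θ v))) := by
  have main : ∀ u : Sph d, ∃ X : Sph d → ℝ, Measurable X ∧ (∃ C, ∀ z, |X z| ≤ C) ∧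
      (fun z => ((privUnit d p θ u).rnDeriv (unif d) z).toReal) =ᵐ[unif d] X ∧
      Var[X; unif d] = (p - (1 - capQ d θ v)) ^ 2 / (capQ d θ v * (1 - capQ d θ v)) := by
    intro u
    have hq := capQ_pos hθ.1 u
    have hq' := sub_pos.2 (capQ_lt_one hθ.2 u)
    have ha : 0 ≤ p / (1 - capQ d θ u) := div_nonneg hp.1 hq'.le
    have hb : 0 ≤ (1 - p) / capQ d θ u := div_nonneg (sub_nonneg.2 hp.2) hq.le
    refine ⟨_, measurable_capStep θ (p / (1 - capQ d θ u)) ((1 - p) / capQ d θ u) u,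
      ⟨_, abs_capStep_le _ _ _ _⟩, ?_, ?_⟩
    · rw [privUnit_eq_withDensity hθ]
      filter_upwards [Measure.rnDeriv_withDensity (unif d)
        (measurable_capStep θ (p / (1 - capQ d θ u)) ((1 - p) / capQ d θ u) u).ennreal_ofReal]
        with z hz
      rw [hz, ENNReal.toReal_ofReal (capStep_nonneg ha hb _ _ _)]
    · rw [variance_capStep, capQ_congr θ v u]
      field_simp
      ring
  have hone := Measure.rnDeriv_self (unif d)
  rcases hxy with ⟨rfl, hy⟩ | ⟨rfl, hx⟩
  · obtain ⟨u, rfl⟩ := Option.ne_none_iff_exists'.1 hy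
    obtain ⟨X, hX, ⟨C, hC⟩, hae, hvar⟩ := main u
    have hLp : MemLp X 2 (unif d) :=
      MemLp.of_bound hX.aestronglyMeasurable C (Eventually.of_forall hC)
    rw [← hvar, ← variance_const_sub hX.aestronglyMeasurable 1,
      ofReal_variance (X := fun z => 1 - X z) ((memLp_const 1).sub hLp)]
    refine evariance_congr ?_
    filter_upwards [hae, hone] with z hz hz1
    simp [ampVar, extend, hz, hz1]
  · obtain ⟨u, rfl⟩ := Option.ne_none_iff_exists'.1 hx
    obtain ⟨X, hX, ⟨C, hC⟩, hae, hvar⟩ := main u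
    have hLp : MemLp X 2 (unif d) :=
      MemLp.of_bound hX.aestronglyMeasurable C (Eventually.of_forall hC)
    rw [← hvar, ← variance_sub_const hX.aestronglyMeasurable 1,
      ofReal_variance (X := fun z => X z - 1) (hLp.sub (memLp_const 1))]
    refine evariance_congr ?_
    filter_upwards [hae, hone] with z hz hz1
    simp [ampVar, extend, hz, hz1]

lemma privUnitChi_eq {p θ : ℝ} (hp : p ∈ Set.Icc (0 : ℝ) 1)
    (hθ : θ ∈ Set.Ioo (-1 : ℝ) 1) (v : Sph d) :
    privUnitChi d p θ = (((blanketMass (privUnit d p θ) (unif d))⁻¹ *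
      ENNReal.ofReal ((p - (1 - capQ d θ v)) ^ 2 / (capQ d θ v * (1 - capQ d θ v)))) ^
        (1 / 2 : ℝ))⁻¹ := by
  rw [privUnitChi, chiLo]
  congr 1
  refine le_antisymm (iSup_le fun x => iSup_le fun y => iSup_le fun hxy => ?_) ?_
  · rw [evariance_ampVar hp hθ v hxy]
  · have hz : ZeroOut (none : Option (Sph d)) (some v) := Or.inl ⟨rfl, Option.some_ne_none v⟩
    rw [← evariance_ampVar hp hθ v hz]
    exact le_iSup_of_le none (le_iSup_of_le (some v) (le_iSup_of_le hz le_rfl))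

/-- When both values of the density are positive and distinct, the lower shuffle index is the
square root of `γ q (1 - q) / (p - (1 - q))²`. -/
lemma privUnitChi_eq_ofReal {p θ : ℝ} (hp : p ∈ Set.Icc (0 : ℝ) 1)
    (hθ : θ ∈ Set.Ioo (-1 : ℝ) 1) (v : Sph d) (ht : p ≠ 1 - capQ d θ v)
    (h0 : 0 < minDens d p θ v) :
    privUnitChi d p θ = ENNReal.ofReal (√(minDens d p θ v * (capQ d θ v * (1 - capQ d θ v)) /
      (p - (1 - capQ d θ v)) ^ 2)) := by
  have hq := capQ_pos hθ.1 v
  have hq' := sub_pos.2 (capQ_lt_one hθ.2 v)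
  have ht' := sub_ne_zero.2 ht
  have hpos : 0 < (p - (1 - capQ d θ v)) ^ 2 / (capQ d θ v * (1 - capQ d θ v)) := by positivity
  rw [privUnitChi_eq hp hθ v, blanketMass_privUnit hp hθ v ht, ← ENNReal.ofReal_inv_of_pos h0,
    ← ENNReal.ofReal_mul (by positivity), ENNReal.ofReal_rpow_of_pos (by positivity),
    ← ENNReal.ofReal_inv_of_pos (by positivity), ← Real.sqrt_eq_rpow, ← Real.sqrt_inv]
  congr 2
  field_simp

/-- A positive finite lower shuffle index excludes `p ∈ {0, 1}` (no blanket, index `0`) and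
`p = 1 - q` (the output is uniform, index `∞`). -/
lemma of_privUnitChi_eq_ofReal {p θ χ : ℝ} (hp : p ∈ Set.Icc (0 : ℝ) 1)
    (hθ : θ ∈ Set.Ioo (-1 : ℝ) 1) (v : Sph d) (hχ : 0 < χ)
    (h : privUnitChi d p θ = ENNReal.ofReal χ) :
    p ≠ 1 - capQ d θ v ∧ 0 < minDens d p θ v ∧
      χ ^ 2 = minDens d p θ v * (capQ d θ v * (1 - capQ d θ v)) / (p - (1 - capQ d θ v)) ^ 2 := by
  have hq := capQ_pos hθ.1 v
  have hq' := sub_pos.2 (capQ_lt_one hθ.2 v)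
  have ht : p ≠ 1 - capQ d θ v := by
    intro ht
    rw [privUnitChi_eq hp hθ v, ht] at h
    simp at h
  have h0 : 0 < minDens d p θ v := by
    refine (minDens_nonneg hp hθ v).lt_of_ne fun h0 => ?_
    have ht' := sub_ne_zero.2 ht
    have hpos : 0 < (p - (1 - capQ d θ v)) ^ 2 / (capQ d θ v * (1 - capQ d θ v)) := by positivity
    rw [privUnitChi_eq hp hθ v, blanketMass_privUnit hp hθ v ht, ← h0, ENNReal.ofReal_zero,
      ENNReal.inv_zero, ENNReal.top_mul (ENNReal.ofReal_pos.2 hpos).ne',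
      ENNReal.top_rpow_of_pos (by norm_num), ENNReal.inv_top] at h
    exact (ENNReal.ofReal_pos.2 hχ).ne h
  refine ⟨ht, h0, ?_⟩
  rw [privUnitChi_eq_ofReal hp hθ v ht h0,
    ENNReal.ofReal_eq_ofReal_iff (Real.sqrt_nonneg _) hχ.le] at h
  rw [← h, Real.sq_sqrt (by positivity)]

end Density

/-! ### Optimal unbiased estimation for two-valued densities -/

section Estimation

lemma ofReal_integral_le_lintegral_ofReal {Ω : Type*} [MeasurableSpace Ω] {μ : Measure Ω}
    {f : Ω → ℝ} (hf : Integrable f μ) :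
    ENNReal.ofReal (∫ x, f x ∂μ) ≤ ∫⁻ x, ENNReal.ofReal (f x) ∂μ := by
  calc ENNReal.ofReal (∫ x, f x ∂μ) ≤ ENNReal.ofReal (∫ x, max (f x) 0 ∂μ) :=
        ENNReal.ofReal_le_ofReal (integral_mono hf hf.pos_part fun x => le_max_left _ _)
    _ = ∫⁻ x, ENNReal.ofReal (max (f x) 0) ∂μ :=
        ofReal_integral_eq_lintegral_ofReal hf.pos_part
          (Eventually.of_forall fun x => le_max_right _ _)
    _ = ∫⁻ x, ENNReal.ofReal (f x) ∂μ := by simp [ENNReal.ofReal_max]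

lemma integral_bind_kernel {α β F : Type*} [MeasurableSpace α] [MeasurableSpace β]
    [NormedAddCommGroup F] [NormedSpace ℝ F] {μ : Measure α} {κ : Kernel α β} {f : β → F}
    (hf : Integrable f (μ.bind κ)) :
    ∫ x, f x ∂(μ.bind κ) = ∫ a, ∫ x, f x ∂(κ a) ∂μ := by
  rw [Measure.comp_eq_comp_const_apply] at hf ⊢
  rw [Kernel.integral_comp hf, Kernel.const_apply]

variable {d : ℕ}

/-- The family of laws with density `a` on the cap around the input and `b` off it. -/
noncomputable def stepLaw (d : ℕ) (θ a b : ℝ) (v : Sph d) : Measure (Sph d) :=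
  (unif d).withDensity fun u => ENNReal.ofReal (capStep d θ a b v u)

/-- The length of the mean of `stepLaw d θ a b v`, signed in the direction `v`. -/
noncomputable def stepMean (d : ℕ) (θ a b : ℝ) (v : Sph d) : ℝ := (a - b) * capInt d θ v

lemma stepMean_congr (θ a b : ℝ) (v w : Sph d) : stepMean d θ a b v = stepMean d θ a b w := by
  rw [stepMean, stepMean, capInt_congr θ v w]

lemma integral_stepLaw {F : Type*} [NormedAddCommGroup F] [NormedSpace ℝ F]
    {a b : ℝ} (ha : 0 ≤ a) (hb : 0 ≤ b) (θ : ℝ) (v : Sph d) (g : Sph d → F) :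
    ∫ u, g u ∂(stepLaw d θ a b v) = ∫ u, capStep d θ a b v u • g u ∂(unif d) := by
  rw [stepLaw, integral_withDensity_eq_integral_toReal_smul
    (measurable_capStep θ a b v).ennreal_ofReal
    (Eventually.of_forall fun _ => ENNReal.ofReal_lt_top)]
  simp only [ENNReal.toReal_ofReal (capStep_nonneg ha hb θ v _)]

lemma integrable_stepLaw_iff {F : Type*} [NormedAddCommGroup F] [NormedSpace ℝ F]
    {a b : ℝ} (ha : 0 ≤ a) (hb : 0 ≤ b) (θ : ℝ) (v : Sph d) {g : Sph d → F} :
    Integrable g (stepLaw d θ a b v) ↔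
      Integrable (fun u => capStep d θ a b v u • g u) (unif d) := by
  rw [stepLaw, integrable_withDensity_iff_integrable_smul'
    (measurable_capStep θ a b v).ennreal_ofReal
    (Eventually.of_forall fun _ => ENNReal.ofReal_lt_top)]
  simp only [ENNReal.toReal_ofReal (capStep_nonneg ha hb θ v _)]

/-- If both density values are positive, integrability under one of the laws is integrability
under the uniform measure. -/
lemma integrable_unif_of_stepLaw {F : Type*} [NormedAddCommGroup F] [NormedSpace ℝ F]
    {a b : ℝ} (ha : 0 < a) (hb : 0 < b) (θ : ℝ) (v : Sph d) {g : Sph d → F}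
    (hg : Integrable g (stepLaw d θ a b v)) : Integrable g (unif d) := by
  have h := integrable_capStep_smul θ a⁻¹ b⁻¹ v ((integrable_stepLaw_iff ha.le hb.le θ v).1 hg)
  refine h.congr (Eventually.of_forall fun u => ?_)
  simp only [smul_smul, capStep]
  split_ifs
  · rw [inv_mul_cancel₀ ha.ne', one_smul]
  · rw [inv_mul_cancel₀ hb.ne', one_smul]

lemma ae_unif_of_ae_stepLaw {a b : ℝ} (ha : 0 < a) (hb : 0 < b) (θ : ℝ) (v : Sph d)
    {P : Sph d → Prop} (h : ∀ᵐ u ∂(stepLaw d θ a b v), P u) : ∀ᵐ u ∂(unif d), P u := by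
  refine (withDensity_absolutelyContinuous'
    (measurable_capStep θ a b v).ennreal_ofReal.aemeasurable
    (Eventually.of_forall fun u => ?_)).ae_le h
  simp only [ne_eq, ENNReal.ofReal_eq_zero, not_le, capStep]
  split_ifs <;> assumption

lemma integral_capStep_mul_inner (θ a b : ℝ) (v : Sph d) {g : Sph d → E d}
    (hg : Integrable g (unif d)) (w : E d) :
    ∫ y, capStep d θ a b v y * inner ℝ (g y) w ∂(unif d) =
      inner ℝ (∫ y, capStep d θ a b v y • g y ∂(unif d)) w := by
  rw [real_inner_comm, ← integral_inner (integrable_capStep_smul θ a b v hg)]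
  refine integral_congr_ae (Eventually.of_forall fun y => ?_)
  simp only [inner_smul_right]
  rw [real_inner_comm]

/-- The estimator `u ↦ u / m`, where `m` is the length of the mean output. -/
noncomputable def scaleEst (d : ℕ) (m : ℝ) (u : Sph d) : E d := m⁻¹ • (u : E d)

lemma measurable_scaleEst (m : ℝ) : Measurable (scaleEst d m) := by
  unfold scaleEst
  fun_prop

/-- The conditional mean squared error given the output `y` is bounded below by a function that
is affine in the conditional mean, by `‖x - y / m‖² ≥ 0`. -/
lemma affine_le_lintegral_enorm_sq {ν : Measure (E d)} [IsProbabilityMeasure ν]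
    (hν : Integrable (fun x => x) ν) (m : ℝ) (y v : Sph d) :
    ENNReal.ofReal (2 / m * inner ℝ (∫ x, x ∂ν) (y : E d) - 1 / m ^ 2 -
      2 * inner ℝ (∫ x, x ∂ν) (v : E d) + 1) ≤ ∫⁻ x, ‖x - (v : E d)‖ₑ ^ 2 ∂ν := by
  have hi : ∀ w : E d, Integrable (fun x => inner ℝ x w) ν := fun w => by
    simpa only [real_inner_comm] using hν.const_inner (𝕜 := ℝ) w
  have hii : ∀ w : E d, ∫ x, inner ℝ x w ∂ν = inner ℝ (∫ x, x ∂ν) w := fun w => by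
    rw [real_inner_comm, ← integral_inner hν]
    exact integral_congr_ae (Eventually.of_forall fun x => real_inner_comm _ _)
  have hL₁ : Integrable (fun x => 2 / m * inner ℝ x (y : E d) - 1 / m ^ 2) ν :=
    ((hi y).const_mul _).sub (integrable_const _)
  have hL₂ : Integrable (fun x => 2 / m * inner ℝ x (y : E d) - 1 / m ^ 2 -
      2 * inner ℝ x (v : E d)) ν := hL₁.sub ((hi v).const_mul _)
  have hL : Integrable (fun x => 2 / m * inner ℝ x (y : E d) - 1 / m ^ 2 -
      2 * inner ℝ x (v : E d) + 1) ν := hL₂.add (integrable_const _)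
  have hLint : ∫ x, (2 / m * inner ℝ x (y : E d) - 1 / m ^ 2 -
      2 * inner ℝ x (v : E d) + 1) ∂ν = 2 / m * inner ℝ (∫ x, x ∂ν) (y : E d) - 1 / m ^ 2 -
      2 * inner ℝ (∫ x, x ∂ν) (v : E d) + 1 := by
    rw [integral_add hL₂ (integrable_const _), integral_sub hL₁ ((hi v).const_mul _), integral_sub ((hi y).const_mul _) (integrable_const _),
      integral_const_mul, integral_const_mul, hii, hii]
    simp
  rw [← hLint]
  refine (ofReal_integral_le_lintegral_ofReal hL).trans (lintegral_mono fun x => ?_)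
  rw [← ofReal_norm, ← ENNReal.ofReal_pow (norm_nonneg _)]
  refine ENNReal.ofReal_le_ofReal ?_
  have h1 := sq_nonneg ‖x - m⁻¹ • (y : E d)‖
  rw [norm_sub_sq_real, inner_smul_right, norm_smul, norm_coe_sph, mul_one, Real.norm_eq_abs,
    sq_abs, inv_pow] at h1
  rw [norm_sub_sq_real, norm_coe_sph]
  have h2 : 2 / m * inner ℝ x (y : E d) = 2 * (m⁻¹ * inner ℝ x (y : E d)) := by ring
  rw [h2, one_div]
  linarith

variable [NeZero d]

section

variable {θ a b : ℝ} (ha : 0 ≤ a) (hb : 0 ≤ b)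
  (hmass : ∀ v : Sph d, a * (1 - capQ d θ v) + b * capQ d θ v = 1) {m : ℝ} (hm0 : m ≠ 0)
  (hm : ∀ v : Sph d, stepMean d θ a b v = m)

include ha hb hm hm0 hmass

lemma unbiased_scaleEst :
    Unbiased (stepLaw d θ a b) (Kernel.deterministic (scaleEst d m) (measurable_scaleEst m)) := by
  intro v
  have hprob : IsProbabilityMeasure (stepLaw d θ a b v) :=
    isProbabilityMeasure_withDensity_capStep ha hb θ v (hmass v)
  rw [Measure.deterministic_comp_eq_map]
  refine ⟨?_, ?_⟩
  · rw [integrable_map_measure (by fun_prop) (measurable_scaleEst m).aemeasurable]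
    exact Integrable.of_bound (C := ‖m⁻¹‖) (measurable_scaleEst m).aestronglyMeasurable
      (Eventually.of_forall fun u => by simp [scaleEst, norm_smul])
  · rw [integral_map (measurable_scaleEst m).aemeasurable (by fun_prop)]
    simp only [scaleEst]
    rw [integral_smul, integral_stepLaw ha hb, integral_capStep_smul_coe, ← stepMean, hm,
      smul_smul, inv_mul_cancel₀ hm0, one_smul]

lemma err_scaleEst :
    err (stepLaw d θ a b) (Kernel.deterministic (scaleEst d m) (measurable_scaleEst m)) =
      ENNReal.ofReal (1 / m ^ 2 - 1) := by
  have hne := nonempty_sph d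
  have key : ∀ v : Sph d, ∫⁻ x, ‖x - (v : E d)‖ₑ ^ 2
      ∂((stepLaw d θ a b v).bind
        (Kernel.deterministic (scaleEst d m) (measurable_scaleEst m))) =
      ENNReal.ofReal (1 / m ^ 2 - 1) := by
    intro v
    have hprob : IsProbabilityMeasure (stepLaw d θ a b v) :=
      isProbabilityMeasure_withDensity_capStep ha hb θ v (hmass v)
    have hsq : ∀ u : Sph d, ‖scaleEst d m u - (v : E d)‖ₑ ^ 2 =
        ENNReal.ofReal (1 / m ^ 2 + 1 - 2 / m * inner ℝ (u : E d) (v : E d)) := by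
      intro u
      rw [← ofReal_norm, ← ENNReal.ofReal_pow (norm_nonneg _), norm_sub_sq_real,
        scaleEst, norm_smul, norm_coe_sph, norm_coe_sph, inner_smul_left, Real.norm_eq_abs,
        mul_one, sq_abs]
      congr 1
      simp only [conj_trivial]
      field_simp
      ring
    have hint : Integrable (fun u : Sph d => inner ℝ (u : E d) (v : E d))
        (stepLaw d θ a b v) :=
      Integrable.of_bound (C := 1) (continuous_inner_sph v).aestronglyMeasurable
        (Eventually.of_forall fun u => abs_inner_sph_le_one u v)
    have hmean : ∫ u, inner ℝ (u : E d) (v : E d) ∂(stepLaw d θ a b v) = m := by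
      have h1 : Integrable (fun u : Sph d => (u : E d)) (stepLaw d θ a b v) :=
        Integrable.of_bound (C := 1) (Continuous.aestronglyMeasurable (by fun_prop))
          (Eventually.of_forall fun u => (norm_coe_sph u).le)
      have h2 := integral_inner (𝕜 := ℝ) h1 (v : E d)
      rw [integral_stepLaw ha hb θ v (fun u => (u : E d)), integral_capStep_smul_coe, ← stepMean,
        hm, inner_smul_right, inner_coe_self_sph, mul_one] at h2
      rw [← h2]
      exact integral_congr_ae (Eventually.of_forall fun u => real_inner_comm _ _)
    rw [Measure.deterministic_comp_eq_map, lintegral_map (by fun_prop) (measurable_scaleEst m)]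
    simp only [hsq]
    have hI : Integrable (fun u : Sph d => 1 / m ^ 2 + 1 - 2 / m * inner ℝ (u : E d) (v : E d))
        (stepLaw d θ a b v) := (integrable_const _).sub (hint.const_mul _)
    rw [← ofReal_integral_eq_lintegral_ofReal hI,
      integral_sub (integrable_const _) (hint.const_mul _), integral_const_mul, hmean]
    · congr 1
      simp
      field_simp
      ring
    · refine Eventually.of_forall fun u => ?_
      have h3 : 1 / m ^ 2 + 1 - 2 / m * inner ℝ (u : E d) (v : E d) =
          ‖scaleEst d m u - (v : E d)‖ ^ 2 := by
        rw [norm_sub_sq_real, scaleEst, norm_smul, norm_coe_sph, norm_coe_sph, inner_smul_left,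
          Real.norm_eq_abs, mul_one, sq_abs]
        simp only [conj_trivial]
        field_simp
        ring
      simp only [Pi.zero_apply, h3]
      positivity
  rw [err]
  simp only [key, ciSup_const]

end

/-- Averaging over the input turns unbiasedness into `E⟨g(Y), Y⟩ = 1 / m` for `Y` uniform, where
`g` is the conditional mean of the estimate: given the output `y`, the input-averaged density
has mean `m y`. -/
lemma integral_inner_of_unbiased {θ a b m : ℝ} (hm0 : m ≠ 0)
    (hm : ∀ v : Sph d, stepMean d θ a b v = m) {g : Sph d → E d} (hg : Integrable g (unif d))
    (hub : ∀ v : Sph d, ∫ y, capStep d θ a b v y • g y ∂(unif d) = (v : E d)) :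
    ∫ y, inner ℝ (g y) (y : E d) ∂(unif d) = 1 / m := by
  have hint : Integrable (fun z : Sph d × Sph d =>
      capStep d θ a b z.1 z.2 * inner ℝ (g z.2) (z.1 : E d)) ((unif d).prod (unif d)) := by
    have h1 : Integrable (fun z : Sph d × Sph d => inner ℝ (g z.2) (z.1 : E d))
        ((unif d).prod (unif d)) := by
      refine (hg.norm.comp_snd (unif d)).mono'
        (hg.aestronglyMeasurable.comp_snd.inner (by fun_prop))
        (Eventually.of_forall fun z => ?_)
      simpa [norm_coe_sph] using norm_inner_le_norm (𝕜 := ℝ) (g z.2) (z.1 : E d)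
    exact h1.bdd_mul (measurable_capStep_uncurry θ a b).aestronglyMeasurable
      (Eventually.of_forall fun z => abs_capStep_le θ a b z.1 z.2)
  have hswap := integral_integral_swap
    (f := fun v y => capStep d θ a b v y * inner ℝ (g y) (v : E d)) hint
  have hleft : ∀ v : Sph d,
      ∫ y, capStep d θ a b v y * inner ℝ (g y) (v : E d) ∂(unif d) = 1 := by
    intro v
    rw [integral_capStep_mul_inner θ a b v hg, hub, inner_coe_self_sph]
  have hright : ∀ y : Sph d,
      ∫ v, capStep d θ a b v y * inner ℝ (g y) (v : E d) ∂(unif d) =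
        m * inner ℝ (g y) (y : E d) := by
    intro y
    have h := integral_inner (𝕜 := ℝ)
      (integrable_capStep_smul θ a b y (integrable_coe_sph (d := d))) (g y)
    rw [integral_capStep_smul_coe, ← stepMean, hm, inner_smul_right] at h
    rw [← h]
    refine integral_congr_ae (Eventually.of_forall fun v => ?_)
    simp only [inner_smul_right, capStep_comm θ a b v y]
  simp only [hleft, hright, integral_const_mul, integral_const, probReal_univ, smul_eq_mul,
    mul_one] at hswap
  exact eq_div_of_mul_eq hm0 (by rw [mul_comm]; exact hswap.symm)

/-- No unbiased estimator, randomized or not, beats `1 / m² - 1`. -/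
lemma le_err_of_unbiased {θ a b : ℝ} (ha : 0 < a) (hb : 0 < b)
    (hmass : ∀ v : Sph d, a * (1 - capQ d θ v) + b * capQ d θ v = 1) {m : ℝ} (hm0 : m ≠ 0)
    (hm : ∀ v : Sph d, stepMean d θ a b v = m) (κ : Kernel (Sph d) (E d)) [IsMarkovKernel κ]
    (hκ : Unbiased (stepLaw d θ a b) κ) :
    ENNReal.ofReal (1 / m ^ 2 - 1) ≤ err (stepLaw d θ a b) κ := by
  obtain ⟨v₀⟩ := nonempty_sph d
  rcases eq_or_ne (err (stepLaw d θ a b) κ) ⊤ with htop | htop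
  · rw [htop]
    exact le_top
  set r := (err (stepLaw d θ a b) κ).toReal with hr
  set g : Sph d → E d := fun y => ∫ x, x ∂(κ y) with hgdef
  have hint : ∀ᵐ y ∂(unif d), Integrable (fun x : E d => x) (κ y) :=
    ae_unif_of_ae_stepLaw ha hb θ v₀ (Measure.ae_integrable_of_integrable_comp (hκ v₀).1)
  have hgm : StronglyMeasurable g := StronglyMeasurable.integral_kernel (by fun_prop)
  have hg : Integrable g (unif d) := by
    refine integrable_unif_of_stepLaw ha hb θ v₀ ?_
    refine (Measure.integrable_integral_norm_of_integrable_comp (hκ v₀).1).mono'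
      hgm.aestronglyMeasurable (Eventually.of_forall fun y => norm_integral_le_integral_norm _)
  have hub : ∀ v : Sph d, ∫ y, capStep d θ a b v y • g y ∂(unif d) = (v : E d) := by
    intro v
    rw [← integral_stepLaw ha.le hb.le, ← (hκ v).2, integral_bind_kernel (hκ v).1]
  have hinner : ∀ v : Sph d, Integrable (fun y => inner ℝ (g y) (v : E d)) (unif d) := fun v => by
    simpa only [real_inner_comm] using hg.const_inner (𝕜 := ℝ) (v : E d)
  have hinner' : Integrable (fun y : Sph d => inner ℝ (g y) (y : E d)) (unif d) := by
    refine hg.norm.mono' (hgm.aestronglyMeasurable.inner (by fun_prop))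
      (Eventually.of_forall fun y => ?_)
    simpa [norm_coe_sph] using norm_inner_le_norm (𝕜 := ℝ) (g y) (y : E d)
  set A : Sph d → ℝ := fun v => ∫ y, capStep d θ a b v y * inner ℝ (g y) (y : E d) ∂(unif d)
    with hA
  -- For each input the affine lower bound integrates to `2 A(v) / m - 1 / m² - 1`.
  have hbound : ∀ v : Sph d, 2 / m * A v - 1 / m ^ 2 - 1 ≤ r := by
    intro v
    set φ : Sph d → ℝ := fun y => 2 / m * inner ℝ (g y) (y : E d) - 1 / m ^ 2 -
      2 * inner ℝ (g y) (v : E d) + 1 with hφ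
    have hφint : Integrable φ (unif d) :=
      (((hinner'.const_mul _).sub (integrable_const _)).sub ((hinner v).const_mul _)).add
        (integrable_const _)
    have hval : ∫ y, capStep d θ a b v y * φ y ∂(unif d) = 2 / m * A v - 1 / m ^ 2 - 1 := by
      have e1 : ∫ y, capStep d θ a b v y * inner ℝ (g y) (v : E d) ∂(unif d) = 1 := by
        rw [integral_capStep_mul_inner θ a b v hg, hub, inner_coe_self_sph]
      have e2 : ∫ y, capStep d θ a b v y ∂(unif d) = 1 := by rw [integral_capStep, hmass]
      have i1 := integrable_capStep_smul θ a b v hinner'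
      have i2 := integrable_capStep_smul θ a b v (hinner v)
      have i3 := integrable_capStep θ a b v
      simp only [smul_eq_mul] at i1 i2
      have hcongr : (fun y => capStep d θ a b v y * φ y) = fun y =>
          2 / m * (capStep d θ a b v y * inner ℝ (g y) (y : E d)) -
            2 * (capStep d θ a b v y * inner ℝ (g y) (v : E d)) +
            (1 - 1 / m ^ 2) * capStep d θ a b v y := by
        ext y
        simp only [hφ]
        ring
      have i12 : Integrable (fun y => 2 / m * (capStep d θ a b v y * inner ℝ (g y) (y : E d)) -
          2 * (capStep d θ a b v y * inner ℝ (g y) (v : E d))) (unif d) :=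
        (i1.const_mul _).sub (i2.const_mul _)
      rw [hcongr, integral_add i12 (i3.const_mul _),
        integral_sub (i1.const_mul _) (i2.const_mul _), integral_const_mul, integral_const_mul,
        integral_const_mul, e1, e2]
      simp only [hA]
      ring
    rw [← hval, hr, ← ENNReal.ofReal_le_iff_le_toReal htop]
    have h1 : ∫⁻ x, ‖x - (v : E d)‖ₑ ^ 2 ∂((stepLaw d θ a b v).bind κ) ≤
        err (stepLaw d θ a b) κ :=
      le_iSup (fun v : Sph d => ∫⁻ x, ‖x - (v : E d)‖ₑ ^ 2 ∂((stepLaw d θ a b v).bind κ)) v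
    refine le_trans ?_ h1
    have hmeas : Measurable fun x : E d => ‖x - (v : E d)‖ₑ ^ 2 := by fun_prop
    rw [Measure.lintegral_bind κ.measurable.aemeasurable hmeas.aemeasurable, stepLaw,
      lintegral_withDensity_eq_lintegral_mul _ (measurable_capStep θ a b v).ennreal_ofReal
        hmeas.lintegral_kernel]
    have hsm := integrable_capStep_smul θ a b v hφint
    simp only [smul_eq_mul] at hsm
    refine (ofReal_integral_le_lintegral_ofReal hsm).trans (lintegral_mono_ae ?_)
    filter_upwards [hint] with y hy
    rw [ENNReal.ofReal_mul (capStep_nonneg ha.le hb.le θ v y), Pi.mul_apply]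
    gcongr
    exact affine_le_lintegral_enorm_sq hy m y v
  have hprod : Integrable (fun z : Sph d × Sph d =>
      capStep d θ a b z.1 z.2 * inner ℝ (g z.2) (z.2 : E d)) ((unif d).prod (unif d)) :=
    (hinner'.comp_snd (unif d)).bdd_mul (measurable_capStep_uncurry θ a b).aestronglyMeasurable
      (Eventually.of_forall fun z => abs_capStep_le θ a b z.1 z.2)
  have hAint : Integrable A (unif d) := hprod.integral_prod_left
  have hAval : ∫ v, A v ∂(unif d) = 1 / m := by
    rw [hA, integral_integral_swap
      (f := fun v y => capStep d θ a b v y * inner ℝ (g y) (y : E d)) hprod, ← integral_inner_of_unbiased hm0 hm hg hub]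
    refine integral_congr_ae (Eventually.of_forall fun y => ?_)
    simp only [integral_mul_const, capStep_comm θ a b _ y, integral_capStep, hmass, one_mul]
  have hfin : ∫ v, (2 / m * A v - (1 / m ^ 2 + 1)) ∂(unif d) ≤ ∫ _, r ∂(unif d) :=
    integral_mono ((hAint.const_mul _).sub (integrable_const _)) (integrable_const _)
      fun v => by
        have := hbound v
        simp only
        linarith
  rw [integral_sub (hAint.const_mul _) (integrable_const _), integral_const_mul, hAval] at hfin
  simp only [integral_const, probReal_univ, smul_eq_mul, one_mul] at hfin
  rw [ENNReal.ofReal_le_iff_le_toReal htop]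
  have h4 : 2 / m * (1 / m) = 2 * (1 / m ^ 2) := by field_simp
  rw [h4] at hfin
  linarith

end Estimation

/-! ### Gaussian isoperimetry for first moments on the line -/

section GaussianLine

/-- The density of the standard Gaussian law. -/
noncomputable def gaussDens (x : ℝ) : ℝ := gaussianPDFReal 0 1 x

/-- The distribution function of the standard Gaussian law. -/
noncomputable def gaussCdf (x : ℝ) : ℝ := (gaussianReal 0 1).real (Set.Iic x)

lemma gaussDens_eq (x : ℝ) :
    gaussDens x = (√(2 * Real.pi))⁻¹ * Real.exp (-(x ^ 2) / 2) := by
  simp [gaussDens, gaussianPDFReal]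

lemma gaussDens_pos (x : ℝ) : 0 < gaussDens x :=
  gaussianPDFReal_pos 0 1 x one_ne_zero

lemma sq_gaussDens (x : ℝ) : gaussDens x ^ 2 = Real.exp (-x ^ 2) / (2 * Real.pi) := by
  rw [gaussDens_eq, mul_pow, inv_pow, Real.sq_sqrt (by positivity), ← Real.exp_nat_mul,
    inv_mul_eq_div]
  congr 2
  push_cast
  ring

lemma hasDerivAt_gaussDens (x : ℝ) : HasDerivAt gaussDens (-x * gaussDens x) x := by
  have h : HasDerivAt (fun y : ℝ => -(y ^ 2) / 2) (-x) x := by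
    refine HasDerivAt.congr_deriv (((hasDerivAt_pow 2 x).neg).div_const 2) ?_
    norm_num
    ring
  have h2 := (h.exp).const_mul (√(2 * Real.pi))⁻¹
  have hfun : gaussDens = fun y => (√(2 * Real.pi))⁻¹ * Real.exp (-(y ^ 2) / 2) :=
    funext gaussDens_eq
  refine HasDerivAt.congr_deriv (hfun ▸ h2) ?_
  rw [gaussDens_eq]
  ring

lemma continuous_gaussDens : Continuous gaussDens :=
  continuous_iff_continuousAt.2 fun x => (hasDerivAt_gaussDens x).continuousAt

lemma integrable_gaussDens : Integrable gaussDens := integrable_gaussianPDFReal 0 1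

lemma tendsto_gaussDens_atTop : Tendsto gaussDens atTop (𝓝 0) := by
  have h : Tendsto (fun x : ℝ => -(x ^ 2) / 2) atTop atBot :=
    (tendsto_neg_atTop_atBot.comp (tendsto_pow_atTop two_ne_zero)).atBot_div_const two_pos
  have h2 := (Real.tendsto_exp_atBot.comp h).const_mul (√(2 * Real.pi))⁻¹
  rw [mul_zero] at h2
  exact h2.congr fun x => (gaussDens_eq x).symm

lemma gaussCdf_eq_integral (x : ℝ) : gaussCdf x = ∫ y in Set.Iic x, gaussDens y := by
  rw [gaussCdf, measureReal_def, gaussianReal_apply_eq_integral 0 one_ne_zero,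
    ENNReal.toReal_ofReal (integral_nonneg fun y => gaussianPDFReal_nonneg 0 1 y)]
  rfl

lemma hasDerivAt_gaussCdf (x : ℝ) : HasDerivAt gaussCdf (gaussDens x) x := by
  have hi := integrable_gaussDens
  have h : gaussCdf = fun y => gaussCdf 0 + ∫ z in (0 : ℝ)..y, gaussDens z := by
    ext y
    rw [gaussCdf_eq_integral, gaussCdf_eq_integral,
      ← intervalIntegral.integral_Iic_sub_Iic hi.integrableOn hi.integrableOn]
    ring
  rw [h]
  exact (intervalIntegral.integral_hasDerivAt_right hi.intervalIntegrable
    (continuous_gaussDens.stronglyMeasurableAtFilter _ _)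
    continuous_gaussDens.continuousAt).const_add _

lemma continuous_gaussCdf : Continuous gaussCdf :=
  continuous_iff_continuousAt.2 fun x => (hasDerivAt_gaussCdf x).continuousAt

lemma gaussCdf_eq_cdf : gaussCdf = cdf (gaussianReal 0 1) := by
  ext x
  rw [cdf_eq_real, gaussCdf]

lemma tendsto_gaussCdf_atTop : Tendsto gaussCdf atTop (𝓝 1) := by
  rw [gaussCdf_eq_cdf]
  exact tendsto_cdf_atTop _

lemma tendsto_gaussCdf_atBot : Tendsto gaussCdf atBot (𝓝 0) := by
  rw [gaussCdf_eq_cdf]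
  exact tendsto_cdf_atBot _

lemma exists_gaussCdf_eq {q : ℝ} (h0 : 0 < q) (h1 : q < 1) : ∃ s, gaussCdf s = q := by
  obtain ⟨a, ha⟩ := (tendsto_gaussCdf_atBot.eventually (eventually_lt_nhds h0)).exists
  obtain ⟨b, hb⟩ := (tendsto_gaussCdf_atTop.eventually (eventually_gt_nhds h1)).exists
  exact mem_range_of_exists_le_of_exists_ge continuous_gaussCdf ⟨a, ha.le⟩ ⟨b, hb.le⟩

lemma gaussianReal_Ioi (s : ℝ) : (gaussianReal 0 1).real (Set.Ioi s) = 1 - gaussCdf s := by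
  rw [← Set.compl_Iic, probReal_compl_eq_one_sub measurableSet_Iic, gaussCdf]

lemma gaussCdf_neg (s : ℝ) : gaussCdf (-s) = 1 - gaussCdf s := by
  have h := gaussianReal_map_neg (μ := 0) (v := 1)
  rw [neg_zero] at h
  have hna : NullSingletonClass (gaussianReal 0 1) :=
    nullSingletonClass_gaussianReal one_ne_zero
  rw [gaussCdf, ← h, map_measureReal_apply measurable_neg measurableSet_Iic, ← gaussianReal_Ioi,
    measureReal_def, measureReal_def, measure_congr (Ioi_ae_eq_Ici (a := s))]
  congr 2
  ext x
  simp

lemma gaussCdf_zero : gaussCdf 0 = 1 / 2 := by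
  have h := gaussCdf_neg 0
  rw [neg_zero] at h
  linarith

/-- `4 Φ (1 - Φ) - exp (-s²)` vanishes at `0` and at `∞`. Its derivative is the density times a
function that vanishes at `0`, increases up to `√(1 - 2 / π)` and decreases afterwards, so the
difference first increases and then decreases. -/
lemma exp_neg_sq_le_of_nonneg {s : ℝ} (hs : 0 ≤ s) :
    Real.exp (-s ^ 2) ≤ 4 * gaussCdf s * (1 - gaussCdf s) := by
  set c := √(2 * Real.pi) with hc
  have hcpos : 0 < c := by positivity
  have hc2 : c ^ 2 = 2 * Real.pi := Real.sq_sqrt (by positivity)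
  have hexp : ∀ x, Real.exp (-x ^ 2) = c ^ 2 * gaussDens x ^ 2 := fun x => by
    rw [sq_gaussDens, hc2]
    field_simp
  set ψ : ℝ → ℝ := fun x => 4 * gaussCdf x * (1 - gaussCdf x) - c ^ 2 * gaussDens x ^ 2 with hψ
  set B : ℝ → ℝ := fun x => 4 * (1 - 2 * gaussCdf x) + 2 * c ^ 2 * (x * gaussDens x) with hB
  have hψd : ∀ x, HasDerivAt ψ (gaussDens x * B x) x := fun x => by
    have h := (((hasDerivAt_gaussCdf x).const_mul 4).mul
      ((hasDerivAt_gaussCdf x).const_sub 1)).sub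
      (((hasDerivAt_gaussDens x).pow 2).const_mul (c ^ 2))
    refine h.congr_deriv ?_
    simp only [hB]
    push_cast
    ring
  have hBd : ∀ x, HasDerivAt B (2 * gaussDens x * (c ^ 2 * (1 - x ^ 2) - 4)) x := fun x => by
    have h := ((((hasDerivAt_gaussCdf x).const_mul 2).const_sub 1).const_mul 4).add
      (((hasDerivAt_id x).mul (hasDerivAt_gaussDens x)).const_mul (2 * c ^ 2))
    refine h.congr_deriv ?_
    simp only [id]
    ring
  have hB0 : B 0 = 0 := by simp [hB, gaussCdf_zero]
  set x₀ := √(1 - 4 / c ^ 2) with hx₀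
  have hx₀sq : x₀ ^ 2 = 1 - 4 / c ^ 2 := by
    refine Real.sq_sqrt ?_
    rw [hc2, sub_nonneg, div_le_one (by positivity)]
    linarith [Real.pi_gt_three]
  have hfac : ∀ x : ℝ, c ^ 2 * (1 - x ^ 2) - 4 = c ^ 2 * (x₀ ^ 2 - x ^ 2) := fun x => by
    rw [hx₀sq]
    field_simp
    ring
  have hx₀0 : 0 ≤ x₀ := Real.sqrt_nonneg _
  have hmono : MonotoneOn B (Set.Icc 0 x₀) :=
    monotoneOn_of_hasDerivWithinAt_nonneg (convex_Icc _ _)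
      (fun x _ => (hBd x).continuousAt.continuousWithinAt)
      (fun x _ => (hBd x).hasDerivWithinAt) fun x hx => by
        rw [interior_Icc] at hx
        have h1 : x ^ 2 ≤ x₀ ^ 2 := pow_le_pow_left₀ hx.1.le hx.2.le 2
        rw [hfac]
        exact mul_nonneg (mul_nonneg two_pos.le (gaussDens_pos x).le)
          (mul_nonneg (sq_nonneg c) (sub_nonneg.2 h1))
  have hanti : AntitoneOn B (Set.Ici x₀) :=
    antitoneOn_of_hasDerivWithinAt_nonpos (convex_Ici _)
      (fun x _ => (hBd x).continuousAt.continuousWithinAt)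
      (fun x _ => (hBd x).hasDerivWithinAt) fun x hx => by
        rw [interior_Ici] at hx
        have h1 : x₀ ^ 2 ≤ x ^ 2 := pow_le_pow_left₀ hx₀0 (le_of_lt hx) 2
        rw [hfac]
        exact mul_nonpos_of_nonneg_of_nonpos (mul_nonneg two_pos.le (gaussDens_pos x).le)
          (mul_nonpos_of_nonneg_of_nonpos (sq_nonneg c) (sub_nonpos.2 h1))
  have hBpos : ∀ x ∈ Set.Icc 0 x₀, 0 ≤ B x := fun x hx => by
    rw [← hB0]
    exact hmono ⟨le_rfl, hx₀0⟩ hx hx.1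
  suffices h : 0 ≤ ψ s by
    rw [hexp]
    exact sub_nonneg.1 h
  rcases le_or_gt 0 (B s) with hBs | hBs
  · have hψmono : MonotoneOn ψ (Set.Icc 0 s) :=
      monotoneOn_of_hasDerivWithinAt_nonneg (convex_Icc _ _)
        (fun x _ => (hψd x).continuousAt.continuousWithinAt)
        (fun x _ => (hψd x).hasDerivWithinAt) fun x hx => by
          rw [interior_Icc] at hx
          refine mul_nonneg (gaussDens_pos x).le ?_
          rcases le_total x x₀ with h | h
          · exact hBpos x ⟨hx.1.le, h⟩
          · exact hBs.trans (hanti h (h.trans hx.2.le) hx.2.le)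
    have hψ0 : ψ 0 = 0 := by
      simp only [hψ, gaussCdf_zero, sq_gaussDens, hc2]
      simp only [ne_eq, OfNat.ofNat_ne_zero, not_false_eq_true, zero_pow, neg_zero, Real.exp_zero]
      field_simp
      norm_num
    rw [← hψ0]
    exact hψmono ⟨le_rfl, hs⟩ ⟨hs, le_rfl⟩ hs
  · have hsx : x₀ ≤ s := by
      by_contra hcon
      exact absurd (hBpos s ⟨hs, (not_le.1 hcon).le⟩) (not_le.2 hBs)
    have hψanti : AntitoneOn ψ (Set.Ici s) :=
      antitoneOn_of_hasDerivWithinAt_nonpos (convex_Ici _)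
        (fun x _ => (hψd x).continuousAt.continuousWithinAt)
        (fun x _ => (hψd x).hasDerivWithinAt) fun x hx => by
          rw [interior_Ici] at hx
          exact mul_nonpos_of_nonneg_of_nonpos (gaussDens_pos x).le
            ((hanti hsx (hsx.trans (le_of_lt hx)) (le_of_lt hx)).trans hBs.le)
    have hlim : Tendsto ψ atTop (𝓝 0) := by
      have h := ((tendsto_gaussCdf_atTop.const_mul 4).mul
        (tendsto_gaussCdf_atTop.const_sub 1)).sub
        ((tendsto_gaussDens_atTop.pow 2).const_mul (c ^ 2))
      simpa using h
    exact le_of_tendsto hlim ((eventually_ge_atTop s).mono fun x hx =>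
      hψanti (Set.mem_Ici.2 le_rfl) hx hx)

/-- Among half-lines, the ratio of the squared Gaussian first moment to the variance of the
indicator is largest for the one that starts at the origin. -/
lemma sq_gaussDens_le (s : ℝ) :
    gaussDens s ^ 2 ≤ 2 / Real.pi * (gaussCdf s * (1 - gaussCdf s)) := by
  have h : Real.exp (-s ^ 2) ≤ 4 * gaussCdf s * (1 - gaussCdf s) := by
    rcases le_total 0 s with hs | hs
    · exact exp_neg_sq_le_of_nonneg hs
    · have h1 := exp_neg_sq_le_of_nonneg (neg_nonneg.2 hs)
      rw [gaussCdf_neg, neg_sq] at h1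
      linarith
  rw [sq_gaussDens, div_le_iff₀ (by positivity)]
  calc Real.exp (-s ^ 2) ≤ 4 * gaussCdf s * (1 - gaussCdf s) := h
    _ = 2 / Real.pi * (gaussCdf s * (1 - gaussCdf s)) * (2 * Real.pi) := by
      field_simp
      ring

lemma integrable_id_gaussianReal : Integrable (fun x : ℝ => x) (gaussianReal 0 1) :=
  (memLp_id_gaussianReal 1).integrable le_rfl

lemma setIntegral_Ioi_gaussianReal (s : ℝ) :
    ∫ x in Set.Ioi s, x ∂(gaussianReal 0 1) = gaussDens s := by
  have hint : Integrable fun x : ℝ => x * gaussDens x := by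
    have h := integrable_id_gaussianReal
    rw [gaussianReal_of_var_ne_zero 0 one_ne_zero, integrable_withDensity_iff_integrable_smul'
      (measurable_gaussianPDF 0 1) (Eventually.of_forall fun _ => gaussianPDF_lt_top)] at h
    refine h.congr (Eventually.of_forall fun x => ?_)
    simp only [toReal_gaussianPDF, smul_eq_mul, gaussDens]
    ring
  have h := integral_Ioi_of_hasDerivAt_of_tendsto (a := s) (m := 0)
    (f := fun x => -gaussDens x) (f' := fun x => x * gaussDens x)
    continuous_gaussDens.neg.continuousWithinAt
    (fun x _ => (hasDerivAt_gaussDens x).neg.congr_deriv (by ring)) hint.integrableOn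
    (by simpa using tendsto_gaussDens_atTop.neg)
  rw [zero_sub, neg_neg] at h
  rw [← h, gaussianReal_of_var_ne_zero 0 one_ne_zero,
    setIntegral_withDensity_eq_setIntegral_toReal_smul (measurable_gaussianPDF 0 1)
      (Eventually.of_forall fun _ => gaussianPDF_lt_top) _ measurableSet_Ioi]
  refine setIntegral_congr_fun measurableSet_Ioi fun x _ => ?_
  simp only [toReal_gaussianPDF, smul_eq_mul, gaussDens]
  ring

/-- Bathtub principle: among events of given probability, a half-line event has the largest
Gaussian first moment. -/
lemma setIntegral_le_gaussDens {Ω : Type*} [MeasurableSpace Ω] {P : Measure Ω}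
    [IsProbabilityMeasure P] {G : Ω → ℝ} (hG : Measurable G)
    (hlaw : P.map G = gaussianReal 0 1) {A : Set Ω} (hA : MeasurableSet A) {s : ℝ}
    (hAs : P.real A = 1 - gaussCdf s) : ∫ ω in A, G ω ∂P ≤ gaussDens s := by
  have hGi : Integrable G P := by
    have h := integrable_id_gaussianReal
    rw [← hlaw, integrable_map_measure (by fun_prop) hG.aemeasurable] at h
    exact h
  have hGs : Integrable (fun ω => G ω - s) P := hGi.sub (integrable_const s)
  have hT : MeasurableSet (G ⁻¹' Set.Ioi s) := hG measurableSet_Ioi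
  have hsub : ∀ S : Set Ω, ∫ ω in S, (G ω - s) ∂P = ∫ ω in S, G ω ∂P - s * P.real S := by
    intro S
    rw [integral_sub hGi.integrableOn (integrable_const s)]
    simp [mul_comm]
  have hle : ∫ ω in A, (G ω - s) ∂P ≤ ∫ ω in G ⁻¹' Set.Ioi s, (G ω - s) ∂P := by
    rw [← integral_indicator hA, ← integral_indicator hT]
    refine integral_mono (hGs.indicator hA) (hGs.indicator hT) fun ω => ?_
    simp only [Set.indicator, Set.mem_preimage, Set.mem_Ioi]
    split_ifs <;> linarith
  have hTm : P.real (G ⁻¹' Set.Ioi s) = 1 - gaussCdf s := by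
    rw [← map_measureReal_apply hG measurableSet_Ioi, hlaw, gaussianReal_Ioi]
  have hTi : ∫ ω in G ⁻¹' Set.Ioi s, G ω ∂P = gaussDens s := by
    rw [← setIntegral_Ioi_gaussianReal, ← hlaw,
      setIntegral_map measurableSet_Ioi (by fun_prop) hG.aemeasurable]
  rw [hsub, hsub, hAs, hTm, hTi] at hle
  linarith

end GaussianLine

/-! ### The Gaussian measure in polar coordinates -/

section GaussianSpace

variable {d : ℕ}

lemma integrable_norm_pow_mul_exp [NeZero d] (k : ℕ) :
    Integrable fun x : E d => ‖x‖ ^ k * Real.exp (-(1 / 2) * ‖x‖ ^ 2) := by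
  rw [integrable_fun_norm_addHaar volume
    (f := fun r : ℝ => r ^ k * Real.exp (-(1 / 2) * r ^ 2))]
  have hs : (-1 : ℝ) < ((Module.finrank ℝ (E d) - 1 + k : ℕ) : ℝ) :=
    lt_of_lt_of_le (by norm_num) (Nat.cast_nonneg _)
  have h := integrableOn_rpow_mul_exp_neg_mul_sq (b := 1 / 2) (by norm_num) hs
  refine h.congr_fun (fun r _ => ?_) measurableSet_Ioi
  simp only [Real.rpow_natCast, smul_eq_mul]
  ring

/-- The radial integral `∫ ‖x‖^k exp(-‖x‖²/2) dx`. -/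
noncomputable def radialMoment (d k : ℕ) : ℝ :=
  ∫ x : E d, ‖x‖ ^ k * Real.exp (-(1 / 2) * ‖x‖ ^ 2)

lemma integral_Ioi_pow_mul_exp (n : ℕ) :
    ∫ r in Set.Ioi (0 : ℝ), r ^ (n + 2) * Real.exp (-(1 / 2) * r ^ 2) =
      (n + 1) * ∫ r in Set.Ioi (0 : ℝ), r ^ n * Real.exp (-(1 / 2) * r ^ 2) := by
  have key : ∀ m : ℕ, ∫ r in Set.Ioi (0 : ℝ), r ^ m * Real.exp (-(1 / 2) * r ^ 2) =
      (1 / 2 : ℝ) ^ (-((m : ℝ) + 1) / 2) * (1 / 2) * Real.Gamma (((m : ℝ) + 1) / 2) := by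
    intro m
    rw [← integral_rpow_mul_exp_neg_mul_rpow two_pos
      (lt_of_lt_of_le (by norm_num) (Nat.cast_nonneg m)) (by norm_num)]
    refine setIntegral_congr_fun measurableSet_Ioi fun r _ => ?_
    simp only [Real.rpow_natCast, Real.rpow_two]
  rw [key, key]
  have h1 : (((n + 2 : ℕ) : ℝ) + 1) / 2 = ((n : ℝ) + 1) / 2 + 1 := by
    push_cast
    ring
  have h2 : -(((n + 2 : ℕ) : ℝ) + 1) / 2 = -((n : ℝ) + 1) / 2 + (-1) := by
    push_cast
    ring
  have h3 : ((n : ℝ) + 1) / 2 ≠ 0 := by positivity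
  rw [h1, h2, Real.Gamma_add_one h3, Real.rpow_add (by norm_num), Real.rpow_neg_one]
  ring

lemma radialMoment_add_two [NeZero d] (k : ℕ) :
    radialMoment d (k + 2) = (d + k) * radialMoment d k := by
  have hd : 1 ≤ d := NeZero.one_le
  have key : ∀ m : ℕ, radialMoment d m = d • (volume : Measure (E d)).real (Metric.ball 0 1) •
      ∫ r in Set.Ioi (0 : ℝ), r ^ (d - 1 + m) * Real.exp (-(1 / 2) * r ^ 2) := by
    intro m
    rw [radialMoment, integral_fun_norm_addHaar volume
      (fun r : ℝ => r ^ m * Real.exp (-(1 / 2) * r ^ 2)), finrank_euclideanSpace_fin]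
    congr 2
    refine setIntegral_congr_fun measurableSet_Ioi fun r _ => ?_
    simp only [smul_eq_mul]
    ring
  rw [key, key, ← add_assoc, integral_Ioi_pow_mul_exp]
  have : ((d - 1 + k : ℕ) : ℝ) + 1 = d + k := by
    rw [Nat.cast_add, Nat.cast_sub hd]
    push_cast
    ring
  rw [this]
  simp only [smul_eq_mul, nsmul_eq_mul]
  ring

lemma radialMoment_zero_pos (d : ℕ) : 0 < radialMoment d 0 := by
  simp only [radialMoment, pow_zero, one_mul]
  rw [GaussianFourier.integral_rexp_neg_mul_sq_norm (by norm_num)]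
  positivity

/-- The expected norm of a standard Gaussian vector is `√d (1 + O(1/d))`, by the tangent bound
`2 t ≥ 3 t² - t⁴` at `t = ‖x‖ / √d`. -/
lemma sqrt_mul_le_radialMoment_one [NeZero d] :
    √d * (1 - 1 / d) * radialMoment d 0 ≤ radialMoment d 1 := by
  have hd : (0 : ℝ) < d := Nat.cast_pos.2 (NeZero.pos d)
  set s := √(d : ℝ) with hs
  have hs0 : 0 < s := Real.sqrt_pos.2 hd
  have hs2 : s ^ 2 = d := Real.sq_sqrt hd.le
  have h2 := radialMoment_add_two (d := d) 0
  have h4 := radialMoment_add_two (d := d) 2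
  rw [h2] at h4
  have hmono : ∫ x : E d, (3 / (2 * s) * (‖x‖ ^ 2 * Real.exp (-(1 / 2) * ‖x‖ ^ 2)) -
      1 / (2 * s ^ 3) * (‖x‖ ^ 4 * Real.exp (-(1 / 2) * ‖x‖ ^ 2))) ≤ radialMoment d 1 := by
    refine integral_mono (((integrable_norm_pow_mul_exp 2).const_mul _).sub
      ((integrable_norm_pow_mul_exp 4).const_mul _)) (integrable_norm_pow_mul_exp 1) fun x => ?_
    simp only
    set r := ‖x‖ with hr
    have hr0 : 0 ≤ r := norm_nonneg x
    have hpoly : 3 / (2 * s) * r ^ 2 - 1 / (2 * s ^ 3) * r ^ 4 ≤ r ^ 1 := by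
      have : r ^ 1 - (3 / (2 * s) * r ^ 2 - 1 / (2 * s ^ 3) * r ^ 4) =
          r * ((r - s) ^ 2 * (r + 2 * s)) / (2 * s ^ 3) := by
        field_simp
        ring
      have h5 : 0 ≤ r * ((r - s) ^ 2 * (r + 2 * s)) / (2 * s ^ 3) := by positivity
      linarith
    have := mul_le_mul_of_nonneg_right hpoly (Real.exp_pos (-(1 / 2) * r ^ 2)).le
    linarith
  rw [integral_sub ((integrable_norm_pow_mul_exp 2).const_mul _)
    ((integrable_norm_pow_mul_exp 4).const_mul _), integral_const_mul, integral_const_mul] at hmono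
  change 3 / (2 * s) * radialMoment d (0 + 2) - 1 / (2 * s ^ 3) * radialMoment d (2 + 2) ≤ _
    at hmono
  rw [h2, h4] at hmono
  refine le_trans (le_of_eq ?_) hmono
  rw [← hs2]
  push_cast
  field_simp
  ring

/-- Polar coordinates: the integral of a product of a radial and an angular function factors. -/
lemma integral_radial_mul_angular [NeZero d] (F : E d → ℝ) (w : ℝ → ℝ) (g : Sph d → ℝ)
    (hF : ∀ x : ({0}ᶜ : Set (E d)), F x = w ‖(x : E d)‖ * g (homeomorphUnitSphereProd (E d) x).1) :
    ∫ x, F x = (∫ x : E d, w ‖x‖) * ∫ u, g u ∂(unif d) := by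
  set σ := (volume : Measure (E d)).toSphere with hσ
  set ρ := Measure.volumeIoiPow (Module.finrank ℝ (E d) - 1) with hρ
  have key : ∀ (F' : E d → ℝ) (g' : Sph d → ℝ), (∀ x : ({0}ᶜ : Set (E d)),
      F' x = w ‖(x : E d)‖ * g' (homeomorphUnitSphereProd (E d) x).1) →
      ∫ x, F' x = (∫ u, g' u ∂σ) * ∫ r : Set.Ioi (0 : ℝ), w r ∂ρ := by
    intro F' g' hF'
    calc ∫ x, F' x = ∫ x : ({0}ᶜ : Set (E d)), F' x ∂((volume : Measure (E d)).comap (↑)) := by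
          rw [integral_subtype_comap (measurableSet_singleton _).compl fun x => F' x,
            restrict_compl_singleton]
      _ = ∫ z : Sph d × Set.Ioi (0 : ℝ), g' z.1 * w z.2 ∂(σ.prod ρ) := by
          rw [← (volume : Measure (E d)).measurePreserving_homeomorphUnitSphereProd.integral_comp
            (Homeomorph.measurableEmbedding _)]
          refine integral_congr_ae (Eventually.of_forall fun x => ?_)
          simp only [hF' x, homeomorphUnitSphereProd_apply_snd_coe]
          ring
      _ = _ := integral_prod_mul (fun u => g' u) (fun r : Set.Ioi (0 : ℝ) => w r)
  have hσ0 : σ.real Set.univ ≠ 0 := by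
    rw [hσ, Measure.toSphere_real_apply_univ]
    have h1 : 0 < (volume : Measure (E d)).real (Metric.ball 0 1) :=
      ENNReal.toReal_pos (Metric.isOpen_ball.measure_pos volume ⟨(0 : E d), by simp⟩).ne'
        measure_ball_lt_top.ne
    have h2 : 0 < Module.finrank ℝ (E d) := Module.finrank_pos
    positivity
  have hone := key (fun x => w ‖x‖) (fun _ => 1) fun x => (mul_one _).symm
  rw [integral_const, smul_eq_mul, mul_one] at hone
  rw [key F g hF, hone, unif_eq_smul, integral_smul_measure, ENNReal.toReal_inv, ← measureReal_def,
    smul_eq_mul, ← hσ]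
  field_simp

/-- The standard Gaussian measure on `ℝ^d`, as a density with respect to the volume. -/
noncomputable def gaussMeas (d : ℕ) : Measure (E d) :=
  volume.withDensity fun x =>
    ENNReal.ofReal ((radialMoment d 0)⁻¹ * Real.exp (-(1 / 2) * ‖x‖ ^ 2))

lemma integral_gaussMeas {F : Type*} [NormedAddCommGroup F] [NormedSpace ℝ F] (f : E d → F) :
    ∫ x, f x ∂(gaussMeas d) =
      ∫ x, ((radialMoment d 0)⁻¹ * Real.exp (-(1 / 2) * ‖x‖ ^ 2)) • f x := by
  have h0 := radialMoment_zero_pos d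
  rw [gaussMeas, integral_withDensity_eq_integral_toReal_smul (by fun_prop)
    (Eventually.of_forall fun _ => ENNReal.ofReal_lt_top)]
  refine integral_congr_ae (Eventually.of_forall fun x => ?_)
  simp only
  rw [ENNReal.toReal_ofReal (by positivity)]

instance isProbabilityMeasure_gaussMeas [NeZero d] : IsProbabilityMeasure (gaussMeas d) := by
  have h0 := radialMoment_zero_pos d
  have hi := integrable_norm_pow_mul_exp (d := d) 0
  simp only [pow_zero, one_mul] at hi
  refine ⟨?_⟩
  rw [gaussMeas, withDensity_apply _ .univ, Measure.restrict_univ,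
    ← ofReal_integral_eq_lintegral_ofReal (hi.const_mul _)
      (Eventually.of_forall fun x => by positivity), integral_const_mul]
  have : ∫ x : E d, Real.exp (-(1 / 2) * ‖x‖ ^ 2) = radialMoment d 0 := by simp [radialMoment]
  rw [this, inv_mul_cancel₀ h0.ne', ENNReal.ofReal_one]

/-- The coordinates of a standard Gaussian vector are standard Gaussian. -/
lemma map_inner_gaussMeas [NeZero d] (v : Sph d) :
    (gaussMeas d).map (fun x => inner ℝ x (v : E d)) = gaussianReal 0 1 := by
  have hm : Measurable fun x : E d => inner ℝ x (v : E d) := by fun_prop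
  have hprob : IsProbabilityMeasure ((gaussMeas d).map fun x => inner ℝ x (v : E d)) :=
    Measure.isProbabilityMeasure_map hm.aemeasurable
  have hb : (0 : ℝ) < ((1 / 2 : ℂ)).re := by norm_num
  have h0 := radialMoment_zero_pos d
  have hZ : ∫ x : E d, Complex.exp (-(1 / 2 : ℂ) * ‖x‖ ^ 2) = (radialMoment d 0 : ℂ) := by
    rw [radialMoment, ← integral_complex_ofReal]
    refine integral_congr_ae (Eventually.of_forall fun x => ?_)
    simp
  have hZ' := GaussianFourier.integral_cexp_neg_mul_sq_norm (V := E d) hb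
  rw [hZ] at hZ'
  refine Measure.ext_of_charFun (funext fun t => ?_)
  rw [charFun_gaussianReal, charFun_apply, integral_map hm.aemeasurable (by fun_prop),
    integral_gaussMeas]
  have hform := GaussianFourier.integral_cexp_neg_mul_sq_norm_add hb (t * Complex.I) (v : E d)
  rw [← hZ', norm_coe_sph] at hform
  have hcongr : ∀ x : E d, ((radialMoment d 0)⁻¹ * Real.exp (-(1 / 2) * ‖x‖ ^ 2)) •
      Complex.exp ((inner ℝ (inner ℝ x (v : E d)) t : ℝ) * Complex.I) =
      (radialMoment d 0 : ℂ)⁻¹ * Complex.exp (-(1 / 2 : ℂ) * ‖x‖ ^ 2 +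
        t * Complex.I * (inner ℝ (v : E d) x : ℝ)) := by
    intro x
    rw [Complex.exp_add, Complex.real_smul, real_inner_comm x (v : E d)]
    push_cast
    rw [mul_assoc]
    congr 3
    simp only [RCLike.inner_apply, conj_trivial]
    push_cast
    ring
  simp only [hcongr]
  rw [integral_const_mul, hform, ← mul_assoc,
    inv_mul_cancel₀ (Complex.ofReal_ne_zero.2 h0.ne'), one_mul]
  congr 1
  simp only [mul_pow, Complex.I_sq]
  push_cast
  ring

/-- The cone over a spherical cap. -/
def cone (d : ℕ) (θ : ℝ) (v : Sph d) : Set (E d) := {x | θ * ‖x‖ ≤ inner ℝ x (v : E d)}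

lemma measurableSet_cone (θ : ℝ) (v : Sph d) : MeasurableSet (cone d θ v) :=
  (isClosed_le (by fun_prop) (by fun_prop)).measurableSet

lemma coe_eq_norm_smul_dir (x : ({0}ᶜ : Set (E d))) :
    (x : E d) = ‖(x : E d)‖ • ((homeomorphUnitSphereProd (E d) x).1 : E d) := by
  have hx : ‖(x : E d)‖ ≠ 0 := norm_ne_zero_iff.2 x.2
  simp [hx]

lemma mem_cone_iff_dir_mem_cap (θ : ℝ) (v : Sph d) (x : ({0}ᶜ : Set (E d))) :
    (x : E d) ∈ cone d θ v ↔ (homeomorphUnitSphereProd (E d) x).1 ∈ cap d θ v := by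
  have hx : 0 < ‖(x : E d)‖ := norm_pos_iff.2 x.2
  have h : inner ℝ (x : E d) (v : E d) =
      ‖(x : E d)‖ * inner ℝ ((homeomorphUnitSphereProd (E d) x).1 : E d) (v : E d) := by
    conv_lhs => rw [coe_eq_norm_smul_dir x]
    rw [inner_smul_left, conj_trivial]
  simp only [cone, cap, Set.mem_ofPred_eq]
  rw [h, mul_comm θ, mul_le_mul_iff_right₀ hx]

variable [NeZero d]

lemma gaussMeas_cone (θ : ℝ) (v : Sph d) :
    (gaussMeas d).real (cone d θ v) = 1 - capQ d θ v := by
  have h0 := radialMoment_zero_pos d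
  have h := integral_radial_mul_angular
    (fun x => ((radialMoment d 0)⁻¹ * Real.exp (-(1 / 2) * ‖x‖ ^ 2)) •
      (cone d θ v).indicator (fun _ => (1 : ℝ)) x)
    (fun r => (radialMoment d 0)⁻¹ * Real.exp (-(1 / 2) * r ^ 2))
    ((cap d θ v).indicator fun _ => 1) fun x => by
      simp only [smul_eq_mul]
      congr 1
      by_cases hx : (x : E d) ∈ cone d θ v
      · rw [Set.indicator_of_mem hx,
          Set.indicator_of_mem ((mem_cone_iff_dir_mem_cap θ v x).1 hx)]
      · rw [Set.indicator_of_notMem hx,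
          Set.indicator_of_notMem (mt (mem_cone_iff_dir_mem_cap θ v x).2 hx)]
  rw [← integral_gaussMeas, integral_indicator_const _ (measurableSet_cone θ v),
    integral_indicator_const _ (measurableSet_cap θ v), integral_const_mul, measureReal_cap] at h
  have h1 : ∫ x : E d, Real.exp (-(1 / 2) * ‖x‖ ^ 2) = radialMoment d 0 := by simp [radialMoment]
  rw [h1, inv_mul_cancel₀ h0.ne', one_mul, smul_eq_mul, smul_eq_mul, mul_one, mul_one] at h
  exact h

lemma setIntegral_cone_inner (θ : ℝ) (v : Sph d) :
    ∫ x in cone d θ v, inner ℝ x (v : E d) ∂(gaussMeas d) =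
      radialMoment d 1 / radialMoment d 0 * capInt d θ v := by
  have h := integral_radial_mul_angular
    (fun x => ((radialMoment d 0)⁻¹ * Real.exp (-(1 / 2) * ‖x‖ ^ 2)) •
      (cone d θ v).indicator (fun x => inner ℝ x (v : E d)) x)
    (fun r => (radialMoment d 0)⁻¹ * (r ^ 1 * Real.exp (-(1 / 2) * r ^ 2)))
    ((cap d θ v).indicator fun u => inner ℝ (u : E d) (v : E d)) fun x => by
      by_cases hx : (x : E d) ∈ cone d θ v
      · have hin : inner ℝ (x : E d) (v : E d) =
            ‖(x : E d)‖ * inner ℝ ((homeomorphUnitSphereProd (E d) x).1 : E d) (v : E d) := by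
          conv_lhs => rw [coe_eq_norm_smul_dir x]
          rw [inner_smul_left, conj_trivial]
        rw [Set.indicator_of_mem hx,
          Set.indicator_of_mem ((mem_cone_iff_dir_mem_cap θ v x).1 hx), hin, smul_eq_mul]
        ring
      · rw [Set.indicator_of_notMem hx,
          Set.indicator_of_notMem (mt (mem_cone_iff_dir_mem_cap θ v x).2 hx), smul_zero, mul_zero]
  rw [← integral_gaussMeas, integral_indicator (measurableSet_cone θ v),
    integral_indicator (measurableSet_cap θ v), integral_const_mul] at h
  rw [h, ← capInt, ← radialMoment, div_eq_inv_mul]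

/-- The first moment of a cap against the variance of its indicator, uniformly in `θ`: the
cone over the cap is compared with the half-space of the same Gaussian measure. -/
lemma sq_capInt_mul_le {θ : ℝ} (hθ : θ ∈ Set.Ioo (-1 : ℝ) 1) (v : Sph d) :
    (√d * (1 - 1 / d) * capInt d θ v) ^ 2 ≤
      2 / Real.pi * (capQ d θ v * (1 - capQ d θ v)) := by
  obtain ⟨s, hs⟩ := exists_gaussCdf_eq (capQ_pos hθ.1 v) (capQ_lt_one hθ.2 v)
  have hd : (1 : ℝ) ≤ d := Nat.one_le_cast.2 NeZero.one_le
  have hI := (capInt_pos hθ v).le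
  have hle := setIntegral_le_gaussDens (P := gaussMeas d) (by fun_prop) (map_inner_gaussMeas v)
    (measurableSet_cone θ v) (s := s) (by rw [gaussMeas_cone, hs])
  rw [setIntegral_cone_inner] at hle
  have h1 : √d * (1 - 1 / d) ≤ radialMoment d 1 / radialMoment d 0 := by
    rw [le_div_iff₀ (radialMoment_zero_pos d)]
    exact sqrt_mul_le_radialMoment_one
  have h2 : √d * (1 - 1 / d) * capInt d θ v ≤ gaussDens s :=
    (mul_le_mul_of_nonneg_right h1 hI).trans hle
  have h3 : 0 ≤ √d * (1 - 1 / (d : ℝ)) * capInt d θ v := by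
    have : 0 ≤ 1 - 1 / (d : ℝ) := sub_nonneg.2 ((div_le_one (by linarith)).2 hd)
    positivity
  rw [← hs]
  exact (pow_le_pow_left₀ h3 h2 2).trans (sq_gaussDens_le s)

end GaussianSpace

/-! ### The constant of PrivUnit -/

section Constant

variable {d : ℕ}

open Classical in
/-- The constant `q / ((1 - q) d α²)`, evaluated at an arbitrary point of the sphere; its value
is `0` if the sphere is empty, that is, for `d = 0`. -/
noncomputable def privConst (θ : ℝ) (d : ℕ) : ℝ :=
  if h : Nonempty (Sph d) then
    capQ d θ h.some / ((1 - capQ d θ h.some) * (d * capMean d θ h.some ^ 2))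
  else 0

variable [NeZero d]

lemma privConst_eq (θ : ℝ) (v : Sph d) :
    privConst θ d = capQ d θ v / ((1 - capQ d θ v) * (d * capMean d θ v ^ 2)) := by
  have h : Nonempty (Sph d) := ⟨v⟩
  rw [privConst, dif_pos h, capMean_eq, capMean_eq, capQ_congr θ h.some v,
    capInt_congr θ h.some v]

lemma privConst_eq_capInt {θ : ℝ} (hθ : θ ∈ Set.Ioo (-1 : ℝ) 1) (v : Sph d) :
    privConst θ d = capQ d θ v * (1 - capQ d θ v) / (d * capInt d θ v ^ 2) := by
  have hq' := sub_pos.2 (capQ_lt_one hθ.2 v)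
  have hI := capInt_pos hθ v
  have hd : (0 : ℝ) < d := Nat.cast_pos.2 (NeZero.pos d)
  rw [privConst_eq θ v, capMean_eq]
  field_simp

lemma privConst_pos {θ : ℝ} (hθ : θ ∈ Set.Ioo (-1 : ℝ) 1) : 0 < privConst θ d := by
  obtain ⟨v⟩ := nonempty_sph d
  have hq := capQ_pos hθ.1 v
  have hq' := sub_pos.2 (capQ_lt_one hθ.2 v)
  have hI := capInt_pos hθ v
  have hd : (0 : ℝ) < d := Nat.cast_pos.2 (NeZero.pos d)
  rw [privConst_eq_capInt hθ v]
  positivity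

lemma le_privConst {θ : ℝ} (hθ : θ ∈ Set.Ioo (-1 : ℝ) 1) :
    Real.pi / 2 * (1 - 1 / d) ^ 2 ≤ privConst θ d := by
  obtain ⟨v⟩ := nonempty_sph d
  have hI := capInt_pos hθ v
  have hd : (0 : ℝ) < d := Nat.cast_pos.2 (NeZero.pos d)
  have h := sq_capInt_mul_le hθ v
  rw [mul_pow, mul_pow, Real.sq_sqrt hd.le] at h
  rw [privConst_eq_capInt hθ v, le_div_iff₀ (by positivity)]
  calc Real.pi / 2 * (1 - 1 / (d : ℝ)) ^ 2 * (d * capInt d θ v ^ 2)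
      = Real.pi / 2 * (d * (1 - 1 / (d : ℝ)) ^ 2 * capInt d θ v ^ 2) := by ring
    _ ≤ Real.pi / 2 * (2 / Real.pi * (capQ d θ v * (1 - capQ d θ v))) := by gcongr
    _ = capQ d θ v * (1 - capQ d θ v) := by field_simp

lemma tendsto_lower_bound_privConst :
    Tendsto (fun d : ℕ => Real.pi / 2 * (1 - 1 / (d : ℝ)) ^ 2) atTop (𝓝 (Real.pi / 2)) := by
  have h := ((tendsto_one_div_atTop_nhds_zero_nat (𝕜 := ℝ)).const_sub 1).pow 2
  simpa using h.const_mul (Real.pi / 2)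

end Constant

/-! ### Optimal error of PrivUnit in terms of the lower shuffle index -/

section PrivUnitError

variable {d : ℕ} [NeZero d]

/-- The signed length of the mean output of PrivUnit. -/
noncomputable def privMean (d : ℕ) (p θ : ℝ) (v : Sph d) : ℝ :=
  (p - (1 - capQ d θ v)) * capInt d θ v / (capQ d θ v * (1 - capQ d θ v))

/-- The smallest worst-case error of an unbiased estimator for PrivUnit is `1 / m² - 1`, with
`m` the length of the mean output. -/
lemma privUnit_optimal {p θ : ℝ} (hθ : θ ∈ Set.Ioo (-1 : ℝ) 1) (v : Sph d)
    (ht : p ≠ 1 - capQ d θ v) (h0 : 0 < minDens d p θ v) :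
    (∀ κ : Kernel (Sph d) (E d), IsMarkovKernel κ → Unbiased (privUnit d p θ) κ →
      ENNReal.ofReal (1 / privMean d p θ v ^ 2 - 1) ≤ err (privUnit d p θ) κ) ∧
    ∃ (f : Sph d → E d) (hf : Measurable f),
      Unbiased (privUnit d p θ) (Kernel.deterministic f hf) ∧
      err (privUnit d p θ) (Kernel.deterministic f hf) =
        ENNReal.ofReal (1 / privMean d p θ v ^ 2 - 1) := by
  have hq := capQ_pos hθ.1 v
  have hq' := sub_pos.2 (capQ_lt_one hθ.2 v)
  set a := p / (1 - capQ d θ v) with ha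
  set b := (1 - p) / capQ d θ v with hb
  have ha0 : 0 < a := h0.trans_le (min_le_left _ _)
  have hb0 : 0 < b := h0.trans_le (min_le_right _ _)
  have hlaw : privUnit d p θ = stepLaw d θ a b := by
    ext1 u
    rw [privUnit_eq_withDensity hθ, stepLaw, capQ_congr θ u v]
  have hmass : ∀ u : Sph d, a * (1 - capQ d θ u) + b * capQ d θ u = 1 := fun u => by
    rw [capQ_congr θ u v]
    exact privUnit_mass hθ p v
  have hm : ∀ u : Sph d, stepMean d θ a b u = privMean d p θ v := fun u => by
    rw [stepMean_congr θ a b u v, stepMean, privMean, ha, hb]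
    field_simp
    ring
  have hm0 : privMean d p θ v ≠ 0 :=
    div_ne_zero (mul_ne_zero (sub_ne_zero.2 ht) (capInt_pos hθ v).ne') (mul_pos hq hq').ne'
  rw [hlaw]
  exact ⟨fun κ _ hκ => le_err_of_unbiased ha0 hb0 hmass hm0 hm κ hκ, _,
    measurable_scaleEst (privMean d p θ v), unbiased_scaleEst ha0.le hb0.le hmass hm0 hm,
    err_scaleEst ha0.le hb0.le hmass hm0 hm⟩

/-- The lower shuffle index of PrivUnit takes arbitrarily large finite values, near
`p = 1 - q`. -/
lemma exists_privUnitChi_ge {θ : ℝ} (hθ : θ ∈ Set.Ioo (-1 : ℝ) 1) (M : ℝ) :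
    ∃ p ∈ Set.Icc (0 : ℝ) 1, ∃ χ : ℝ, M ≤ χ ∧ privUnitChi d p θ = ENNReal.ofReal χ := by
  obtain ⟨v⟩ := nonempty_sph d
  have hq := capQ_pos hθ.1 v
  have hq1 := capQ_lt_one hθ.2 v
  set q := capQ d θ v with hqdef
  have hq' : 0 < 1 - q := sub_pos.2 hq1
  set w := q * (1 - q) with hw
  have hw0 : 0 < w := mul_pos hq hq'
  set N := max M 1 with hN
  have hN0 : 0 < N := lt_of_lt_of_le one_pos (le_max_right _ _)
  -- With `p = 1 - q + t` and `0 < t ≤ q / 2` the blanket mass `1 - t / q` is at least `1 / 2`.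
  set t := min (q / 2) (√(w / 2) / N) with ht
  have ht0 : 0 < t := by positivity
  have htq : t ≤ q / 2 := min_le_left _ _
  have htN : t ≤ √(w / 2) / N := min_le_right _ _
  have hp : 1 - q + t ∈ Set.Icc (0 : ℝ) 1 := ⟨by linarith, by linarith⟩
  have hγ : 1 / 2 ≤ minDens d (1 - q + t) θ v := by
    refine le_min ?_ ?_
    · rw [← hqdef, le_div_iff₀ hq']
      linarith
    · rw [← hqdef, le_div_iff₀ hq]
      linarith
  have hne : 1 - q + t ≠ 1 - capQ d θ v := by
    rw [← hqdef]
    linarith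
  refine ⟨1 - q + t, hp, _, ?_, privUnitChi_eq_ofReal hp hθ v hne (by linarith)⟩
  rw [← hqdef, ← hw]
  refine (le_max_left M 1).trans (Real.le_sqrt_of_sq_le ?_)
  rw [← hN, show 1 - q + t - (1 - q) = t by ring, le_div_iff₀ (by positivity)]
  rw [le_div_iff₀ hN0] at htN
  calc N ^ 2 * t ^ 2 = (t * N) ^ 2 := by ring
    _ ≤ √(w / 2) ^ 2 := pow_le_pow_left₀ (by positivity) htN 2
    _ = 1 / 2 * w := by rw [Real.sq_sqrt (by positivity)]; ring
    _ ≤ minDens d (1 - q + t) θ v * w := by gcongr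

lemma one_sub_minDens_le {p θ : ℝ} (hθ : θ ∈ Set.Ioo (-1 : ℝ) 1) (v : Sph d) :
    1 - minDens d p θ v ≤
      |p - (1 - capQ d θ v)| / (capQ d θ v * (1 - capQ d θ v)) := by
  have hq := capQ_pos hθ.1 v
  have hq1 := capQ_lt_one hθ.2 v
  set q := capQ d θ v with hqdef
  have hq' : 0 < 1 - q := sub_pos.2 hq1
  have habs1 := neg_abs_le (p - (1 - q))
  have habs2 := le_abs_self (p - (1 - q))
  have habs := abs_nonneg (p - (1 - q))
  rw [sub_le_comm, minDens, ← hqdef]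
  refine le_min ?_ ?_
  · rw [sub_le_iff_le_add, ← sub_le_iff_le_add']
    calc 1 - p / (1 - q) = -(p - (1 - q)) / (1 - q) := by field_simp; ring
      _ ≤ |p - (1 - q)| / (1 - q) := by gcongr; linarith
      _ ≤ |p - (1 - q)| / (q * (1 - q)) := by
        gcongr
        nlinarith
  · rw [sub_le_iff_le_add, ← sub_le_iff_le_add']
    calc 1 - (1 - p) / q = (p - (1 - q)) / q := by field_simp; ring
      _ ≤ |p - (1 - q)| / q := by gcongr
      _ ≤ |p - (1 - q)| / (q * (1 - q)) := by
        gcongr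
        nlinarith

/-- The optimal error is `C d χ² (1 + e)` with `1 + e = (1 - m²) / γ`, and both `1 - γ` and `m²`
are of order `χ⁻¹`. -/
lemma exists_relative_error {p θ χ : ℝ} (hθ : θ ∈ Set.Ioo (-1 : ℝ) 1) (v : Sph d)
    (ht : p ≠ 1 - capQ d θ v) (h0 : 0 < minDens d p θ v)
    (hχ : 2 / (capQ d θ v * (1 - capQ d θ v)) ≤ χ)
    (hχ2 : χ ^ 2 = minDens d p θ v * (capQ d θ v * (1 - capQ d θ v)) /
      (p - (1 - capQ d θ v)) ^ 2) :
    ∃ e : ℝ, |e| ≤ 4 / (capQ d θ v * (1 - capQ d θ v)) ^ 2 * χ⁻¹ ∧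
      privConst θ d * d * χ ^ 2 * (1 + e) = 1 / privMean d p θ v ^ 2 - 1 := by
  have hq := capQ_pos hθ.1 v
  have hq1 := capQ_lt_one hθ.2 v
  have hI := capInt_pos hθ v
  have hI1 := capInt_le θ v
  have hγ1 := minDens_lt_one hθ v ht
  have hγ2 := one_sub_minDens_le (p := p) hθ v
  have hC := privConst_eq_capInt hθ v
  have hd : (0 : ℝ) < d := Nat.cast_pos.2 (NeZero.pos d)
  have ht0 := sub_ne_zero.2 ht
  unfold privMean
  set q := capQ d θ v with hqdef
  set t := p - (1 - q) with htdef
  set γ := minDens d p θ v with hγ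
  set I := capInt d θ v with hIdef
  have hq' : 0 < 1 - q := sub_pos.2 hq1
  set w := q * (1 - q) with hw
  have hw0 : 0 < w := mul_pos hq hq'
  have hw1 : w ≤ 1 := by nlinarith
  have hχ0 : 0 < χ := (by positivity : 0 < 2 / w).trans_le hχ
  have htabs : 0 < |t| := abs_pos.2 ht0
  have htχ : |t| ≤ χ⁻¹ := by
    rw [← one_div, le_div_iff₀ hχ0, ← abs_of_pos hχ0, ← abs_mul,
      ← sq_le_one_iff_abs_le_one, mul_pow, hχ2]
    rw [mul_div_cancel₀ _ (pow_ne_zero 2 ht0)]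
    nlinarith
  have hχw : χ⁻¹ ≤ w / 2 := by
    rw [div_le_iff₀ hw0] at hχ
    rw [inv_le_iff_one_le_mul₀ hχ0]
    linarith
  have hγhalf : 1 / 2 ≤ γ := by
    have : |t| / w ≤ 1 / 2 := by
      rw [div_le_iff₀ hw0]
      linarith
    linarith
  have hm2 : (t * I / w) ^ 2 ≤ |t| / w ^ 2 := by
    rw [div_pow, mul_pow, ← sq_abs t]
    have h1 : I ^ 2 ≤ 1 := pow_le_one₀ hI.le (by linarith)
    gcongr
    calc |t| ^ 2 * I ^ 2 ≤ |t| ^ 2 * 1 := by gcongr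
      _ ≤ |t| := by nlinarith
  have hw2 : |t| / w ≤ |t| / w ^ 2 := by
    gcongr
    nlinarith
  refine ⟨(1 - (t * I / w) ^ 2) / γ - 1, ?_, ?_⟩
  · have he : (1 - (t * I / w) ^ 2) / γ - 1 = (1 - γ - (t * I / w) ^ 2) / γ := by
      field_simp
      ring
    rw [he, abs_div, abs_of_pos h0, div_le_iff₀ h0]
    have hnum : |1 - γ - (t * I / w) ^ 2| ≤ |t| / w ^ 2 + |t| / w ^ 2 := by
      rw [abs_le]
      constructor
      · have h2 : 0 ≤ |t| / w ^ 2 := by positivity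
        linarith
      · have := sq_nonneg (t * I / w)
        have h2 : 0 ≤ |t| / w ^ 2 := by positivity
        linarith
    calc |1 - γ - (t * I / w) ^ 2| ≤ 4 / w ^ 2 * |t| * (1 / 2) := by
          refine hnum.trans (le_of_eq ?_)
          ring
      _ ≤ 4 / w ^ 2 * χ⁻¹ * γ := by gcongr
  · rw [hC, hχ2]
    field_simp
    ring

end PrivUnitError

end ShuffleDP

theorem mainTheorem4 :
    ∃ C : ℝ → ℕ → ℝ,
      (∀ d : ℕ, 2 ≤ d → ∀ θ ∈ Set.Ioo (-1 : ℝ) 1,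
        0 < C θ d ∧
        (∀ v : ShuffleDP.Sph d,
          C θ d = ShuffleDP.capQ d θ v /
            ((1 - ShuffleDP.capQ d θ v) * (d * ShuffleDP.capMean d θ v ^ 2))) ∧
        (∀ M : ℝ, ∃ p ∈ Set.Icc (0 : ℝ) 1, ∃ χ : ℝ, M ≤ χ ∧
          ShuffleDP.privUnitChi d p θ = ENNReal.ofReal χ) ∧
        ∃ K χ₀ : ℝ, 0 < χ₀ ∧ ∀ p ∈ Set.Icc (0 : ℝ) 1, ∀ χ : ℝ, χ₀ ≤ χ →
          ShuffleDP.privUnitChi d p θ = ENNReal.ofReal χ →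
          ∃ e : ℝ, |e| ≤ K * χ⁻¹ ∧
            (∀ κ : Kernel (ShuffleDP.Sph d) (ShuffleDP.E d), IsMarkovKernel κ →
              ShuffleDP.Unbiased (ShuffleDP.privUnit d p θ) κ →
              ENNReal.ofReal (C θ d * d * χ ^ 2 * (1 + e)) ≤
                ShuffleDP.err (ShuffleDP.privUnit d p θ) κ) ∧
            (∃ (f : ShuffleDP.Sph d → ShuffleDP.E d) (hf : Measurable f),
              ShuffleDP.Unbiased (ShuffleDP.privUnit d p θ) (Kernel.deterministic f hf) ∧
              ShuffleDP.err (ShuffleDP.privUnit d p θ) (Kernel.deterministic f hf) =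
                ENNReal.ofReal (C θ d * d * χ ^ 2 * (1 + e)))) ∧
      ((Real.pi / 2 : ℝ) : EReal) ≤
        liminf (fun d : ℕ => ⨅ θ : Set.Ioo (-1 : ℝ) 1, ((C θ d : ℝ) : EReal)) atTop ∧
      (∀ c : ℝ, c < Real.pi / 2 → ∃ d₀ : ℕ, ∀ d : ℕ, 2 ≤ d → d₀ ≤ d →
        ∀ θ ∈ Set.Ioo (-1 : ℝ) 1, ∃ χ₀ : ℝ, 0 < χ₀ ∧
          ∀ p ∈ Set.Icc (0 : ℝ) 1, ∀ χ : ℝ, χ₀ ≤ χ →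
            ShuffleDP.privUnitChi d p θ = ENNReal.ofReal χ →
            ∀ κ : Kernel (ShuffleDP.Sph d) (ShuffleDP.E d), IsMarkovKernel κ →
              ShuffleDP.Unbiased (ShuffleDP.privUnit d p θ) κ →
              ENNReal.ofReal (c * d * χ ^ 2) ≤
                ShuffleDP.err (ShuffleDP.privUnit d p θ) κ) := by
  have asymp : ∀ d : ℕ, 2 ≤ d → ∀ θ ∈ Set.Ioo (-1 : ℝ) 1, ∃ K χ₀ : ℝ, 0 < χ₀ ∧
      ∀ p ∈ Set.Icc (0 : ℝ) 1, ∀ χ : ℝ, χ₀ ≤ χ →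
        ShuffleDP.privUnitChi d p θ = ENNReal.ofReal χ →
        ∃ e : ℝ, |e| ≤ K * χ⁻¹ ∧
          (∀ κ : Kernel (ShuffleDP.Sph d) (ShuffleDP.E d), IsMarkovKernel κ →
            ShuffleDP.Unbiased (ShuffleDP.privUnit d p θ) κ →
            ENNReal.ofReal (ShuffleDP.privConst θ d * d * χ ^ 2 * (1 + e)) ≤
              ShuffleDP.err (ShuffleDP.privUnit d p θ) κ) ∧
          (∃ (f : ShuffleDP.Sph d → ShuffleDP.E d) (hf : Measurable f),
            ShuffleDP.Unbiased (ShuffleDP.privUnit d p θ) (Kernel.deterministic f hf) ∧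
            ShuffleDP.err (ShuffleDP.privUnit d p θ) (Kernel.deterministic f hf) =
              ENNReal.ofReal (ShuffleDP.privConst θ d * d * χ ^ 2 * (1 + e))) := by
    intro d hd θ hθ
    have : NeZero d := ⟨by omega⟩
    obtain ⟨v⟩ := ShuffleDP.nonempty_sph d
    have hw : 0 < ShuffleDP.capQ d θ v * (1 - ShuffleDP.capQ d θ v) :=
      mul_pos (ShuffleDP.capQ_pos hθ.1 v) (sub_pos.2 (ShuffleDP.capQ_lt_one hθ.2 v))
    refine ⟨4 / (ShuffleDP.capQ d θ v * (1 - ShuffleDP.capQ d θ v)) ^ 2, _,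
      div_pos two_pos hw, fun p hp χ hχ h => ?_⟩
    have hχ0 : 0 < χ := (div_pos two_pos hw).trans_le hχ
    obtain ⟨ht, h0, hχ2⟩ := ShuffleDP.of_privUnitChi_eq_ofReal hp hθ v hχ0 h
    obtain ⟨e, he, heq⟩ := ShuffleDP.exists_relative_error hθ v ht h0 hχ hχ2
    refine ⟨e, he, ?_⟩
    rw [heq]
    exact ShuffleDP.privUnit_optimal hθ v ht h0
  refine ⟨ShuffleDP.privConst, fun d hd θ hθ => ?_, ?_, fun c hc => ?_⟩
  · have : NeZero d := ⟨by omega⟩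
    exact ⟨ShuffleDP.privConst_pos hθ, ShuffleDP.privConst_eq θ,
      ShuffleDP.exists_privUnitChi_ge hθ, asymp d hd θ hθ⟩
  · have hlim := (continuous_coe_real_ereal.tendsto (Real.pi / 2)).comp
      ShuffleDP.tendsto_lower_bound_privConst
    rw [← hlim.liminf_eq]
    refine liminf_le_liminf ?_
    filter_upwards [eventually_ge_atTop 1] with d hd
    have : NeZero d := ⟨by omega⟩
    exact le_iInf fun θ => EReal.coe_le_coe_iff.2 (ShuffleDP.le_privConst θ.2)
  · -- `c₁` is a positive number strictly between `max c 0` and `π / 2`; the gap between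
    -- `max c 0` and `c₁` absorbs the relative error.
    set c₀ := max c 0 with hc₀
    have hc₀lt : c₀ < Real.pi / 2 := max_lt hc (by positivity)
    obtain ⟨c₁, h01, h1⟩ := exists_between hc₀lt
    have hc₀nn : 0 ≤ c₀ := le_max_right _ _
    have hc₁ : 0 < c₁ := hc₀nn.trans_lt h01
    obtain ⟨d₀, hd₀⟩ := eventually_atTop.1
      (ShuffleDP.tendsto_lower_bound_privConst.eventually (eventually_gt_nhds h1))
    refine ⟨d₀, fun d hd hdd θ hθ => ?_⟩
    have : NeZero d := ⟨by omega⟩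
    have hC : c₁ ≤ ShuffleDP.privConst θ d := (hd₀ d hdd).le.trans (ShuffleDP.le_privConst hθ)
    obtain ⟨K, χ₀, hχ₀, hmain⟩ := asymp d hd θ hθ
    have hgap : 0 < 1 - c₀ / c₁ := sub_pos.2 ((div_lt_one hc₁).2 h01)
    refine ⟨max χ₀ (K / (1 - c₀ / c₁)), lt_max_of_lt_left hχ₀, fun p hp χ hχ h κ hκm hκ => ?_⟩
    have hχ0 : 0 < χ := hχ₀.trans_le ((le_max_left _ _).trans hχ)
    obtain ⟨e, he, hlow, -⟩ := hmain p hp χ ((le_max_left _ _).trans hχ) h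
    refine le_trans (ENNReal.ofReal_le_ofReal ?_) (hlow κ hκm hκ)
    have hK : K * χ⁻¹ ≤ 1 - c₀ / c₁ := by
      have h2 := (le_max_right _ _).trans hχ
      rw [div_le_iff₀ hgap] at h2
      rw [← div_eq_mul_inv, div_le_iff₀ hχ0]
      linarith
    have he1 : c₀ / c₁ ≤ 1 + e := by
      have := neg_abs_le e
      linarith
    have hC0 : 0 ≤ ShuffleDP.privConst θ d := hc₁.le.trans hC
    have hcC : c ≤ ShuffleDP.privConst θ d * (1 + e) :=
      calc c ≤ c₀ := le_max_left _ _
        _ = c₁ * (c₀ / c₁) := by field_simp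
        _ ≤ ShuffleDP.privConst θ d * (1 + e) := by gcongr
    calc c * d * χ ^ 2 = c * (d * χ ^ 2) := by ring
      _ ≤ ShuffleDP.privConst θ d * (1 + e) * (d * χ ^ 2) := by gcongr
      _ = ShuffleDP.privConst θ d * d * χ ^ 2 * (1 + e) := by ring
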